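/- Let $x_1,\dots,x_n\in\mathbb R^p$ with $\|x_i\|_2=1$ and $y_1,\dots,y_n\in\mathbb R$ with $|y_i|<C$. Consider the two-layer ReLU network $f(W,a,x)=\frac1{\sqrt m}\sum_{r=1}^m a_r\,\sigma(w_r^\top x)$, $\sigma(z)=\max\{z,0\}$, $W=(w_1,\dots,w_m)$, the error $\Delta_i=f(W,a,x_i)-y_i$, the loss $L(W,a)=\frac12\sum_{i=1}^n\Delta_i^2$ with gradient $\frac{\partial L}{\partial w_r}=\sum_i\Delta_i\frac{\partial f_i}{\partial w_r}$, $\frac{\partial f_i}{\partial w_r}=\frac1{\sqrt m}a_r\mathbb I\{w_r^\top x_i\ge0\}x_i$, the neural tangent kernel $H_{ij}=\sum_{r}\big\langle\frac{\partial f_i}{\partial w_r},\frac{\partial f_j}{\partial w_r}\big\rangle$, and the pseudo-loss $\hat L=\frac12\Delta^\top H\Delta$. Let $H^\infty_{ij}=\mathbb E_{w\sim\mathcal N(0,I)}\big[x_i^\top x_j\,\mathbb I\{w^\top x_i\ge0,\,w^\top x_j\ge0\}\big]$ and let $\lambda_0$ be the smallest eigenvalue of $H^\infty$. Only $W$ is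 trained; $a$ stays at its initial value. NAG-SC with step size $\eta$ is the iteration with constant momentum $$v_r(k+1)=w_r(k)-\eta\frac{\partial L}{\partial w_r(k)},\qquad w_r(k+1)=v_r(k+1)+\frac{1-\sqrt{\lambda_0\eta/2}}{1+\sqrt{\lambda_0\eta/2}}\,\big(v_r(k+1)-v_r(k)\big).$$ (1) The limiting ODE of NAG-SC is the Heavy Ball ODE with $b=\sqrt{2\lambda_0}$: $$\ddot w_r(t)+\sqrt{2\lambda_0}\,\dot w_r(t)+\frac{\partial L(W(t),a)}{\partial w_r(t)}=0 .$$ That is, if a curve $X$ of weights is differentiable near $t$ and twice differentiable at $t$, with $X_r(t)^\top x_i\ne0$ for all $r,i$, and $N_\eta$ denotes the NAG-SC update $w(k+1)$ computed from $w(k-1)=X(t-\sqrt\eta)$ and $w(k)=X(t)$, then $$\lim_{\eta\to0^+}\frac{X(t+\sqrt\eta)-N_\eta}{\eta}=\ddot X(t)+\sqrt{2\lambda_0}\,\dot X(t)+\frac{\partial L(X(t),a)}{\partial W}.$$ (2) For every $C$ there is a constant $K>0$ depending only on $C$ such that, for all data as above with $\lambda_0>0$, all $\delta\in(0,1)$ and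 all widths $m\ge K\,\frac{n^6}{\delta^3\lambda_0^4}$, the following holds. If $w_r(0)\sim\mathcal N(0,I)$ and $a_r\sim\mathrm{unif}\{-1,1\}$, $r\in[m]$, are all independent, then with probability at least $1-\delta$ over the initialization every trajectory $W(t)$, $t\ge0$, of the limiting ODE in (1) with initial weights $W(0)$ and $\dot W(0)=0$ satisfies $$L(t)\le\frac4{\lambda_0}\exp\!\big(-\sqrt{\lambda_0/2}\;t\big)\,\hat L(0)\qquad\text{for all }t\ge0 .$$ Here $L(t)$ and $\hat L(0)$ are the loss at time $t$ and the pseudo-loss at time $0$ along the trajectory. Since $\partial L/\partial W$ jumps where some $w_r^\top x_i=0$, trajectories are understood as solutions of the differential inclusion: $W$ is $C^1$, $\dot W$ is locally absolutely continuous, and the equation holds for almost every $t$, where at a kink $w_r^\top x_i=0$ the indicator in $\partial L/\partial w_r$ may be replaced by any number in $[0,1]$. -/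

import Mathlib

open MeasureTheory ProbabilityTheory Filter Topology Set

noncomputable section

namespace NAGSC

/-- First-layer weights `W = (w_1, …, w_m)` with `w_r ∈ ℝ^p` (Euclidean norm on each `w_r`). -/
abbrev Weights (m p : ℕ) : Type := Fin m → EuclideanSpace ℝ (Fin p)

/-- ReLU activation. -/
def relu (z : ℝ) : ℝ := max z 0

/-- The derivative of ReLU, with the convention `σ'(0) = 1`, i.e. the indicator of `z ≥ 0`. -/
def reluDeriv (z : ℝ) : ℝ := if 0 ≤ z then 1 else 0

/-- The (Clarke) subdifferential of ReLU: `{1}` for `z > 0`, `{0}` for `z < 0`, `[0,1]` at `0`. -/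
def reluSubdiff (z : ℝ) : Set ℝ :=
  {s | 0 ≤ s ∧ s ≤ 1 ∧ (0 < z → s = 1) ∧ (z < 0 → s = 0)}

variable {m p n : ℕ}

/-- The network `f(W, a, x) = m^{-1/2} ∑_r a_r σ(w_r ⬝ x)`. -/
def net (a : Fin m → ℝ) (W : Weights m p) (x : EuclideanSpace ℝ (Fin p)) : ℝ :=
  (1 / √(m : ℝ)) * ∑ r, a r * relu (inner ℝ (W r) x)

/-- The error `Δ = f - y`. -/
def err (x : Fin n → EuclideanSpace ℝ (Fin p)) (y : Fin n → ℝ) (a : Fin m → ℝ)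
    (W : Weights m p) (i : Fin n) : ℝ :=
  net a W (x i) - y i

/-- The MSE loss `L = (1/2) ∑_i (f(W, a, x_i) - y_i)^2`. -/
def loss (x : Fin n → EuclideanSpace ℝ (Fin p)) (y : Fin n → ℝ) (a : Fin m → ℝ)
    (W : Weights m p) : ℝ :=
  (1 / 2) * ∑ i, err x y a W i ^ 2

/-- `∂f_i/∂w_r = m^{-1/2} a_r 1{w_r ⬝ x_i ≥ 0} x_i`. -/
def netGrad (x : Fin n → EuclideanSpace ℝ (Fin p)) (a : Fin m → ℝ)
    (W : Weights m p) (i : Fin n) (r : Fin m) : EuclideanSpace ℝ (Fin p) :=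
  (1 / √(m : ℝ) * a r * reluDeriv (inner ℝ (W r) (x i))) • x i

/-- The gradient `∂L/∂w_r = ∑_i (f_i - y_i) ∂f_i/∂w_r` of the loss. -/
def lossGrad (x : Fin n → EuclideanSpace ℝ (Fin p)) (y : Fin n → ℝ) (a : Fin m → ℝ)
    (W : Weights m p) : Weights m p :=
  fun r => ∑ i, err x y a W i • netGrad x a W i r

/-- The set of generalized gradients of the loss: the value of `σ'` at a kink `w_r ⬝ x_i = 0` may be
any number in `[0,1]`. Away from the kinks this is the singleton `{lossGrad x y a W}`. -/
def lossGenGrad (x : Fin n → EuclideanSpace ℝ (Fin p)) (y : Fin n → ℝ) (a : Fin m → ℝ)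
    (W : Weights m p) : Set (Weights m p) :=
  {G | ∃ s : Fin m → Fin n → ℝ, (∀ r i, s r i ∈ reluSubdiff (inner ℝ (W r) (x i))) ∧
    ∀ r, G r = ∑ i, err x y a W i • ((1 / √(m : ℝ) * a r * s r i) • x i)}

/-- The NTK matrix `H_{ij} = ∑_r ⟨∂f_i/∂w_r, ∂f_j/∂w_r⟩`. -/
def ntk (x : Fin n → EuclideanSpace ℝ (Fin p)) (a : Fin m → ℝ) (W : Weights m p) :
    Matrix (Fin n) (Fin n) ℝ :=
  Matrix.of fun i j => ∑ r, inner ℝ (netGrad x a W i r) (netGrad x a W j r)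

/-- The pseudo-loss `L̂ = (1/2) Δᵀ H Δ`. -/
def pseudoLoss (x : Fin n → EuclideanSpace ℝ (Fin p)) (y : Fin n → ℝ) (a : Fin m → ℝ)
    (W : Weights m p) : ℝ :=
  (1 / 2) * (err x y a W ⬝ᵥ (ntk x a W).mulVec (err x y a W))

/-- The limiting kernel
`H^∞_{ij} = E_{w ∼ N(0, I)} [x_i ⬝ x_j 1{w ⬝ x_i ≥ 0, w ⬝ x_j ≥ 0}]`. -/
def limitNTK (x : Fin n → EuclideanSpace ℝ (Fin p)) : Matrix (Fin n) (Fin n) ℝ :=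
  Matrix.of fun i j => ∫ w : EuclideanSpace ℝ (Fin p),
    inner ℝ (x i) (x j) * (reluDeriv (inner ℝ w (x i)) * reluDeriv (inner ℝ w (x j)))
      ∂(stdGaussian (EuclideanSpace ℝ (Fin p)))

/-- `λ₀`, the smallest eigenvalue of `H^∞`. -/
def lam0 (x : Fin n → EuclideanSpace ℝ (Fin p)) : ℝ :=
  sInf (spectrum ℝ (limitNTK x))

/-- Law of the initialization: `w_r ∼ N(0, I)` and `a_r ∼ unif{-1, 1}`, all independent. -/
def initLaw (m p : ℕ) : Measure (Weights m p × (Fin m → ℝ)) :=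
  (Measure.pi fun _ : Fin m => stdGaussian (EuclideanSpace ℝ (Fin p))).prod
    (Measure.pi fun _ : Fin m =>
      (2⁻¹ : ENNReal) • Measure.dirac (1 : ℝ) + (2⁻¹ : ENNReal) • Measure.dirac (-1 : ℝ))

/-- The constant momentum `(1 - √(λη/2)) / (1 + √(λη/2))` of NAG-SC. -/
def nagMomentum (lam η : ℝ) : ℝ := (1 - √(lam * η / 2)) / (1 + √(lam * η / 2))

/-- The half step of NAG-SC: `v(k+1) = w(k) - η ∂L/∂w(k)`. -/
def nagHalf (x : Fin n → EuclideanSpace ℝ (Fin p)) (y : Fin n → ℝ) (a : Fin m → ℝ)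
    (η : ℝ) (W : Weights m p) : Weights m p :=
  W - η • lossGrad x y a W

/-- The NAG-SC update `w(k+1) = v(k+1) + momentum • (v(k+1) - v(k))` as a function of
`w(k-1)` and `w(k)`. -/
def nagStep (x : Fin n → EuclideanSpace ℝ (Fin p)) (y : Fin n → ℝ) (a : Fin m → ℝ)
    (η : ℝ) (Wprev W : Weights m p) : Weights m p :=
  nagHalf x y a η W +
    nagMomentum (lam0 x) η • (nagHalf x y a η W - nagHalf x y a η Wprev)

/-- `W`, restricted to `[0, ∞)`, is a trajectory of the Heavy Ball with Friction system
`ẅ_r + b ẇ_r + ∂L/∂w_r = 0` with `W(0) = W₀`, `Ẇ(0) = 0`.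

As `∂L/∂w_r` is discontinuous at the kinks of ReLU, the equation is understood in the sense of
differential inclusions: `W` is `C¹` with velocity `V`, and `V` is locally absolutely continuous
with `V' + b V + G = 0` a.e. (written in integrated form), where `G(t)` is, for almost
every `t`, a generalized gradient of the loss at `W(t)`. -/
def IsHBFlow (x : Fin n → EuclideanSpace ℝ (Fin p)) (y : Fin n → ℝ) (a : Fin m → ℝ)
    (b : ℝ) (W₀ : Weights m p) (W : ℝ → Weights m p) : Prop :=
  W 0 = W₀ ∧
  ∃ V G : ℝ → Weights m p,
    ContinuousOn V (Ici 0) ∧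
    (∀ t, 0 ≤ t → HasDerivWithinAt W (V t) (Ici 0) t) ∧
    (∀ t, 0 ≤ t → IntervalIntegrable G volume 0 t) ∧
    (∀ᵐ t : ℝ, 0 ≤ t → G t ∈ lossGenGrad x y a (W t)) ∧
    ∀ t, 0 ≤ t → V t = -∫ s in (0 : ℝ)..t, (b • V s + G s)

end NAGSC

end

/-!
If the ReLU gates never switched, the residual `d` would solve a damped linear oscillator driven by
the neural tangent kernel `H`. With damping `b = √(2 λ₀)`, the choice adapted to curvature `λ₀`,
put `A = H - (b² / 4) • 1`: the energy `q ⬝ A⁻¹ q + d ⬝ d` in the variables `q = ḋ + (b / 2) d`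
decays at rate `b`. Gates that do switch act as a perturbation of the oscillator, and they cost half
of that rate.

A wide network keeps this perturbation small by bootstrapping: as long as the residual decays
exponentially, no neuron travels further than `O(1 / √m)`, and at initialization only few neurons
lie that close to one of the kinks. That the initial kernel is close to its expectation, that the
initial residual is bounded and that few neurons are near a kink all follow from first or second
moments over the initialization and Markov's inequality.

The limiting equation of the scheme comes from expanding the momentum at `η = 0`, which turns one
step into a second difference of the curve with time step `√η`, up to a defect `o(η)`.
-/

noncomputable section

namespace NAGSC

variable {m p n : ℕ}

section Consistency

variable {E : Type*} [NormedAddCommGroup E] [NormedSpace ℝ E]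

theorem isLittleO_sub_taylor_two {X X' : ℝ → E} {X'' : E} {t : ℝ}
    (hX : ∀ᶠ s in 𝓝 t, HasDerivAt X (X' s) s) (hX' : HasDerivAt X' X'' t) :
    (fun s => X s - X t - (s - t) • X' t - ((s - t) ^ 2 / 2) • X'') =o[𝓝 t]
      fun s => (s - t) ^ 2 := by
  obtain ⟨ε, hε, hball⟩ := Metric.eventually_nhds_iff_ball.1 hX
  have hderiv : ∀ s ∈ Metric.ball t ε,
      HasDerivWithinAt (fun s => X s - X t - (s - t) • X' t - ((s - t) ^ 2 / 2) • X'')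
        (X' s - X' t - (s - t) • X'') (Metric.ball t ε) s := by
    intro s hs
    have hlin : HasDerivAt (fun s : ℝ => s - t) 1 s := (hasDerivAt_id s).sub_const t
    have hquad : HasDerivAt (fun s : ℝ => (s - t) ^ 2 / 2) (s - t) s := by
      convert! (hlin.pow 2).div_const 2 using 1
      simp
    simpa only [one_smul] using
      ((((hball s hs).sub_const (X t)).fun_sub (hlin.smul_const (X' t))).fun_sub
        (hquad.smul_const X'')).hasDerivWithinAt
  have hlittle := (convex_ball t ε).isLittleO_pow_succ_real (n := 1) (Metric.mem_ball_self hε)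
    hderiv (by simpa using (hasDerivAt_iff_isLittleO.1 hX').mono nhdsWithin_le_nhds)
  simpa [nhdsWithin_eq_nhds.2 (Metric.ball_mem_nhds t hε)] using hlittle

theorem tendsto_second_difference {X X' : ℝ → E} {X'' : E} {t : ℝ}
    (hX : ∀ᶠ s in 𝓝 t, HasDerivAt X (X' s) s) (hX' : HasDerivAt X' X'' t) :
    Tendsto (fun h : ℝ => (h ^ 2)⁻¹ • (X (t + h) - X t - (X t - X (t - h)))) (𝓝[≠] 0)
      (𝓝 X'') := by
  have htaylor := isLittleO_sub_taylor_two hX hX'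
  have hplus : Tendsto (fun h : ℝ => t + h) (𝓝 0) (𝓝 t) :=
    Continuous.tendsto' (by fun_prop) _ _ (add_zero t)
  have hminus : Tendsto (fun h : ℝ => t - h) (𝓝 0) (𝓝 t) :=
    Continuous.tendsto' (by fun_prop) _ _ (sub_zero t)
  have hsum : (fun h : ℝ => X (t + h) - X t - (X t - X (t - h)) - h ^ 2 • X'') =o[𝓝 0]
      fun h => h ^ 2 := by
    refine ((htaylor.comp_tendsto hplus).congr_right fun h => ?_).add
      ((htaylor.comp_tendsto hminus).congr_right fun h => ?_) |>.congr_left fun h => ?_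
    · simp
    · simp
    · simp only [Function.comp_apply, add_sub_cancel_left, sub_sub_cancel_left]
      module
  have hquot := ((hsum.mono nhdsWithin_le_nhds).tendsto_inv_smul_nhds_zero
    (l := 𝓝[≠] 0)).add_const X''
  rw [zero_add] at hquot
  refine hquot.congr' ?_
  filter_upwards [self_mem_nhdsWithin] with h (hh : h ≠ 0)
  rw [smul_sub, inv_smul_smul₀ (pow_ne_zero 2 hh), sub_add_cancel]

theorem tendsto_backward_difference {X : ℝ → E} {X' : E} {t : ℝ} (hX : HasDerivAt X X' t) :
    Tendsto (fun h : ℝ => h⁻¹ • (X t - X (t - h))) (𝓝[≠] 0) (𝓝 X') := by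
  have hneg : Tendsto (fun h : ℝ => -h) (𝓝[≠] 0) (𝓝[≠] 0) :=
    tendsto_nhdsWithin_iff.2 ⟨(Continuous.tendsto' (by fun_prop) _ _ neg_zero).mono_left
      nhdsWithin_le_nhds, by filter_upwards [self_mem_nhdsWithin] with h hh using neg_ne_zero.2 hh⟩
  refine ((hasDerivAt_iff_tendsto_slope_zero.1 hX).comp hneg).congr fun h => ?_
  simp only [Function.comp_apply, inv_neg, ← sub_eq_add_neg]
  module

theorem nagMomentum_sq (lam : ℝ) {h : ℝ} (hh : 0 < h) :
    nagMomentum lam (h ^ 2) = (1 - h * √(lam / 2)) / (1 + h * √(lam / 2)) := by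
  rw [nagMomentum, show lam * h ^ 2 / 2 = h ^ 2 * (lam / 2) by ring,
    Real.sqrt_mul (by positivity), Real.sqrt_sq hh.le]

theorem two_mul_sqrt_half (lam : ℝ) : 2 * √(lam / 2) = √(2 * lam) := by
  rw [show 2 * lam = 2 ^ 2 * (lam / 2) by ring, Real.sqrt_mul (by norm_num),
    Real.sqrt_sq (by norm_num)]

theorem tendsto_one_sub_nagMomentum_sq (lam : ℝ) :
    Tendsto (fun h : ℝ => h⁻¹ * (1 - nagMomentum lam (h ^ 2))) (𝓝[>] 0) (𝓝 √(2 * lam)) := by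
  have hcont : ContinuousAt (fun h : ℝ => 2 * √(lam / 2) / (1 + h * √(lam / 2))) 0 := by
    refine ContinuousAt.div ?_ ?_ (by simp) <;> fun_prop
  have hlim := hcont.tendsto.mono_left (nhdsWithin_le_nhds (s := Ioi 0))
  rw [zero_mul, add_zero, div_one] at hlim
  rw [← two_mul_sqrt_half]
  refine hlim.congr' ?_
  filter_upwards [self_mem_nhdsWithin] with h (hh : 0 < h)
  have : 0 < 1 + h * √(lam / 2) := by positivity
  rw [nagMomentum_sq lam hh]
  field_simp
  ring

theorem tendsto_nagMomentum_sq (lam : ℝ) :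
    Tendsto (fun h : ℝ => nagMomentum lam (h ^ 2)) (𝓝[>] 0) (𝓝 1) := by
  have hlim := ((tendsto_id.mono_left nhdsWithin_le_nhds).mul
    (tendsto_one_sub_nagMomentum_sq lam)).const_sub 1
  rw [zero_mul, sub_zero] at hlim
  refine hlim.congr' ?_
  filter_upwards [self_mem_nhdsWithin] with h (hh : 0 < h)
  rw [id, mul_inv_cancel_left₀ hh.ne', sub_sub_cancel]

/-- One step of Nesterov's accelerated gradient method for the gradient field `g`, with momentum
`β` and step size `η`, as a function of the last two iterates `v` (older) and `w` (newer). -/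
def accelStep (g : E → E) (β η : ℝ) (v w : E) : E :=
  (w - η • g w) + β • ((w - η • g w) - (v - η • g v))

theorem inv_sq_smul_sub_accelStep (g : E → E) (β : ℝ) {h : ℝ} (hh : h ≠ 0) (u v w : E) :
    (h ^ 2)⁻¹ • (u - accelStep g β (h ^ 2) v w) =
      (h ^ 2)⁻¹ • (u - w - (w - v)) + (h⁻¹ * (1 - β)) • (h⁻¹ • (w - v)) + g w
        + β • (g w - g v) := by
  rw [accelStep]
  match_scalars <;> field_simp <;> ring

theorem tendsto_sqrt_nhdsGT_zero : Tendsto (fun η : ℝ => √η) (𝓝[>] 0) (𝓝[>] 0) :=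
  tendsto_nhdsWithin_iff.2 ⟨(Continuous.tendsto' Real.continuous_sqrt _ _ Real.sqrt_zero).mono_left
    nhdsWithin_le_nhds, by filter_upwards [self_mem_nhdsWithin] with η hη using Real.sqrt_pos.2 hη⟩

theorem tendsto_accelStep {g : E → E} (lam : ℝ) {X X' : ℝ → E} {X'' : E} {t : ℝ}
    (hX : ∀ᶠ s in 𝓝 t, HasDerivAt X (X' s) s) (hX' : HasDerivAt X' X'' t)
    (hg : ContinuousAt g (X t)) :
    Tendsto (fun η : ℝ =>
        η⁻¹ • (X (t + √η) - accelStep g (nagMomentum lam η) η (X (t - √η)) (X t)))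
      (𝓝[>] 0) (𝓝 (X'' + √(2 * lam) • X' t + g (X t))) := by
  have hXt : HasDerivAt X (X' t) t := hX.self_of_nhds
  have hnhds : 𝓝[>] (0 : ℝ) ≤ 𝓝[≠] 0 := nhdsWithin_mono _ fun h hh => ne_of_gt hh
  have hgrad : Tendsto (fun h : ℝ => g (X t) - g (X (t - h))) (𝓝[>] 0) (𝓝 0) := by
    have hminus : Tendsto (fun h : ℝ => t - h) (𝓝[>] 0) (𝓝 t) :=
      (Continuous.tendsto' (by fun_prop) _ _ (sub_zero t)).mono_left nhdsWithin_le_nhds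
    simpa using ((hg.comp hXt.continuousAt).tendsto.comp hminus).const_sub (g (X t))
  have hlim := ((((tendsto_second_difference hX hX').mono_left hnhds).add
    ((tendsto_one_sub_nagMomentum_sq lam).smul
      ((tendsto_backward_difference hXt).mono_left hnhds))).add_const (g (X t))).add
    ((tendsto_nagMomentum_sq lam).smul hgrad)
  rw [smul_zero, add_zero] at hlim
  refine (hlim.comp tendsto_sqrt_nhdsGT_zero).congr' ?_
  filter_upwards [self_mem_nhdsWithin] with η (hη : 0 < η)
  rw [Function.comp_apply, ← inv_sq_smul_sub_accelStep g _ (Real.sqrt_pos.2 hη).ne',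
    Real.sq_sqrt hη.le]

end Consistency

theorem continuousAt_reluDeriv {z : ℝ} (hz : z ≠ 0) : ContinuousAt reluDeriv z := by
  rcases lt_or_gt_of_ne hz with hneg | hpos
  · refine continuousAt_const.congr (f := fun _ => (0 : ℝ)) ?_
    filter_upwards [Iio_mem_nhds hneg] with s hs
    exact (if_neg (not_le.2 hs)).symm
  · refine continuousAt_const.congr (f := fun _ => (1 : ℝ)) ?_
    filter_upwards [Ioi_mem_nhds hpos] with s hs
    exact (if_pos (le_of_lt hs)).symm

theorem continuous_relu : Continuous relu := by unfold relu; fun_prop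

theorem continuous_err (x : Fin n → EuclideanSpace ℝ (Fin p)) (y : Fin n → ℝ) (a : Fin m → ℝ)
    (i : Fin n) : Continuous fun W : Weights m p => err x y a W i := by
  have := continuous_relu
  unfold err net
  fun_prop

theorem continuousAt_lossGrad {x : Fin n → EuclideanSpace ℝ (Fin p)} (y : Fin n → ℝ)
    (a : Fin m → ℝ) {W : Weights m p} (hW : ∀ r i, inner ℝ (W r) (x i) ≠ 0) :
    ContinuousAt (lossGrad x y a) W := by
  have hgate (r : Fin m) (i : Fin n) :
      ContinuousAt (fun W : Weights m p => reluDeriv (inner ℝ (W r) (x i))) W :=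
    ContinuousAt.comp (f := fun W : Weights m p => inner ℝ (W r) (x i))
      (continuousAt_reluDeriv (hW r i)) ((continuous_apply r).inner continuous_const).continuousAt
  refine continuousAt_pi.2 fun r => tendsto_finsetSum _ fun i _ => ?_
  exact ((continuous_err x y a i).tendsto W).smul
    ((continuousAt_const.mul (hgate r i)).smul continuousAt_const)

theorem absolutelyContinuousOnInterval_const {F : Type*} [NormedAddCommGroup F] (c : F) (a b : ℝ) :
    AbsolutelyContinuousOnInterval (fun _ : ℝ => c) a b :=
  ((LipschitzWith.const c).lipschitzOnWith (s := uIcc a b)).absolutelyContinuousOnInterval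

theorem absolutelyContinuousOnInterval_finset_sum {ι F : Type*} [NormedAddCommGroup F]
    (s : Finset ι) {f : ι → ℝ → F} {a b : ℝ}
    (hf : ∀ i ∈ s, AbsolutelyContinuousOnInterval (f i) a b) :
    AbsolutelyContinuousOnInterval (fun t => ∑ i ∈ s, f i t) a b := by
  classical
  induction s using Finset.induction_on with
  | empty => simpa only [Finset.sum_empty] using absolutelyContinuousOnInterval_const (0 : F) a b
  | insert j s hj ih =>
    simp only [Finset.sum_insert hj]
    exact (hf j (Finset.mem_insert_self j s)).fun_add
      (ih fun i hi => hf i (Finset.mem_insert_of_mem hi))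

theorem absolutelyContinuousOnInterval_exp_mul (c a b : ℝ) :
    AbsolutelyContinuousOnInterval (fun t : ℝ => Real.exp (c * t)) a b :=
  ContDiffOn.absolutelyContinuousOnInterval (by fun_prop)

theorem absolutelyContinuousOnInterval_congr {X : Type*} [PseudoMetricSpace X] {f g : ℝ → X}
    {a b : ℝ} (hf : AbsolutelyContinuousOnInterval f a b) (h : EqOn f g (uIcc a b)) :
    AbsolutelyContinuousOnInterval g a b := by
  refine Tendsto.congr' ?_ hf
  filter_upwards [mem_inf_of_right (mem_principal_self _)] with I hI
  refine Finset.sum_congr rfl fun i hi => ?_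
  rw [h (hI.1 i hi).1, h (hI.1 i hi).2]

theorem le_of_ae_deriv_nonpos {f : ℝ → ℝ} {a b : ℝ} (hab : a ≤ b)
    (hf : AbsolutelyContinuousOnInterval f a b) (h : ∀ᵐ t, t ∈ Icc a b → deriv f t ≤ 0) :
    f b ≤ f a := by
  rw [← sub_nonpos, ← hf.integral_deriv_eq_sub]
  simpa using intervalIntegral.integral_mono_ae_restrict hab hf.intervalIntegrable_deriv
    intervalIntegrable_const ((ae_restrict_iff' measurableSet_Icc).2 h)

theorem hasDerivAt_exp_mul (c t : ℝ) :
    HasDerivAt (fun t => Real.exp (c * t)) (c * Real.exp (c * t)) t := by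
  simpa [mul_comm] using ((hasDerivAt_id t).const_mul c).exp

theorem le_of_ae_deriv_add_mul_le_exp {f : ℝ → ℝ} {α β c T : ℝ} (hβα : β < α) (hT : 0 ≤ T)
    (hf : AbsolutelyContinuousOnInterval f 0 T)
    (h : ∀ᵐ t, t ∈ Icc 0 T → deriv f t + α * f t ≤ c * Real.exp (-β * t)) :
    f T ≤ f 0 * Real.exp (-α * T) +
      c / (α - β) * (Real.exp (-β * T) - Real.exp (-α * T)) := by
  have hαβ : α - β ≠ 0 := (sub_pos.2 hβα).ne'
  have hmono := le_of_ae_deriv_nonpos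
    (f := fun t => Real.exp (α * t) * f t - c / (α - β) * Real.exp ((α - β) * t)) hT
    (((absolutelyContinuousOnInterval_exp_mul α 0 T).fun_mul hf).fun_sub
      ((absolutelyContinuousOnInterval_exp_mul (α - β) 0 T).const_mul _)) <| by
    filter_upwards [h, hf.ae_differentiableAt] with t ht hdiff htT
    have hderiv := ((hasDerivAt_exp_mul α t).mul
      (hdiff (by rwa [uIcc_of_le hT])).hasDerivAt).fun_sub
      ((hasDerivAt_exp_mul (α - β) t).const_mul (c / (α - β)))
    have hexp : Real.exp ((α - β) * t) = Real.exp (α * t) * Real.exp (-β * t) := by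
      rw [← Real.exp_add]; ring_nf
    have hcancel : c / (α - β) * ((α - β) * Real.exp ((α - β) * t)) =
        Real.exp (α * t) * (c * Real.exp (-β * t)) := by
      rw [hexp]; field_simp
    have hmul := mul_le_mul_of_nonneg_left (ht htT) (Real.exp_pos (α * t)).le
    refine hderiv.deriv.trans_le ?_
    rw [hcancel]
    linarith
  have hexp (γ : ℝ) : Real.exp (γ * T) * Real.exp (-α * T) = Real.exp ((γ - α) * T) := by
    rw [← Real.exp_add]; ring_nf
  have hfinal := mul_le_mul_of_nonneg_right hmono (Real.exp_pos (-α * T)).le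
  have hα := hexp α
  have hβ := hexp (α - β)
  rw [sub_self, zero_mul, Real.exp_zero] at hα
  rw [sub_sub_cancel_left] at hβ
  simp only [mul_zero, Real.exp_zero, one_mul, mul_one] at hfinal
  linear_combination hfinal - f T * hα + c / (α - β) * hβ

theorem abs_le_of_ae_abs_deriv_add_mul_le_exp {f : ℝ → ℝ} {α β c T : ℝ} (hβα : β < α)
    (hT : 0 ≤ T) (hc : 0 ≤ c) (hf : AbsolutelyContinuousOnInterval f 0 T) (hf0 : f 0 = 0)
    (h : ∀ᵐ t, t ∈ Icc 0 T → |deriv f t + α * f t| ≤ c * Real.exp (-β * t)) :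
    |f T| ≤ c / (α - β) * Real.exp (-β * T) := by
  have hdrop : 0 ≤ c / (α - β) * Real.exp (-α * T) :=
    mul_nonneg (div_nonneg hc (sub_pos.2 hβα).le) (Real.exp_pos _).le
  have hpos := le_of_ae_deriv_add_mul_le_exp hβα hT hf <| by
    filter_upwards [h] with t ht htT using (le_abs_self _).trans (ht htT)
  have hneg := le_of_ae_deriv_add_mul_le_exp (c := c) hβα hT hf.fun_neg <| by
    filter_upwards [h] with t ht htT
    rw [deriv.fun_neg]
    linarith [neg_abs_le (deriv f t + α * f t), ht htT]
  rw [hf0] at hpos hneg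
  exact abs_le.2 ⟨by linarith, by linarith⟩

theorem norm_sub_le_of_norm_deriv_le_exp {E : Type*} [NormedAddCommGroup E] [NormedSpace ℝ E]
    {u v : ℝ → E} {β c T : ℝ} (hβ : 0 < β) (hT : 0 ≤ T) (hc : 0 ≤ c)
    (hu : ∀ t ∈ Icc 0 T, HasDerivWithinAt u (v t) (Icc 0 T) t)
    (hv : ∀ t ∈ Icc 0 T, ‖v t‖ ≤ c * Real.exp (-β * t)) : ‖u T - u 0‖ ≤ c / β := by
  have hbound : ∀ t, HasDerivAt (fun t => c / β - c / β * Real.exp (-β * t))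
      (c * Real.exp (-β * t)) t := fun t =>
    (((hasDerivAt_exp_mul (-β) t).const_mul (c / β)).const_sub _).congr_deriv (by field_simp)
  have hdist := image_norm_le_of_norm_deriv_right_le_deriv_boundary
    (f := fun t => u t - u 0) (f' := v)
    (fun t ht => (hu t ht).continuousWithinAt.sub continuousWithinAt_const)
    (fun t ht => ((hu t (Ico_subset_Icc_self ht)).mono_of_mem_nhdsWithin
      (Icc_mem_nhdsGE_of_mem ht)).sub_const _)
    (by simp) hbound (fun t ht => hv t (Ico_subset_Icc_self ht)) (right_mem_Icc.2 hT)
  exact hdist.trans (sub_le_self _ (by positivity))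

theorem lt_of_forall_le_imp_lt {φ : ℝ → ℝ} {c t : ℝ} (ht : 0 ≤ t)
    (hφ : ContinuousOn φ (Icc 0 t)) (h0 : φ 0 < c)
    (h : ∀ T ∈ Icc 0 t, (∀ s ∈ Icc 0 T, φ s ≤ c) → φ T < c) : φ t < c := by
  by_contra! hc
  obtain ⟨T, ⟨hT, hcT⟩, hleast⟩ :=
    (isCompact_Icc.of_isClosed_subset (hφ.preimage_isClosed_of_isClosed isClosed_Icc isClosed_Ici)
      inter_subset_left).exists_isLeast ⟨t, right_mem_Icc.2 ht, mem_Ici.2 hc⟩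
  have hsub : Icc 0 T ⊆ Icc 0 t := Icc_subset_Icc_right hT.2
  obtain ⟨s, hs, hsc⟩ := intermediate_value_Icc hT.1 (hφ.mono hsub) ⟨h0.le, hcT⟩
  obtain rfl : s = T := le_antisymm hs.2 (hleast ⟨hsub hs, hsc.ge⟩)
  refine (h s hT fun τ hτ => ?_).not_ge hcT
  by_contra! hlt
  obtain rfl : τ = s := le_antisymm hτ.2 (hleast ⟨hsub hτ, hlt.le⟩)
  exact hlt.ne' hsc

section ForcedOscillator

open scoped Matrix

variable {ι : Type*} [Fintype ι]

theorem dotProduct_self_nonneg (v : ι → ℝ) : 0 ≤ v ⬝ᵥ v := by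
  simpa using dotProduct_star_self_nonneg v

theorem dotProduct_mulVec_comm {A : Matrix ι ι ℝ} (hA : A.IsHermitian) (v w : ι → ℝ) :
    v ⬝ᵥ A *ᵥ w = w ⬝ᵥ A *ᵥ v := by
  rw [Matrix.dotProduct_mulVec, ← Matrix.mulVec_transpose, dotProduct_comm,
    ← Matrix.conjTranspose_eq_transpose_of_trivial, hA.eq]

theorem posDef_of_coercive {A : Matrix ι ι ℝ} (hA : A.IsHermitian) {μ : ℝ} (hμ : 0 < μ)
    (hcoer : ∀ v, μ * (v ⬝ᵥ v) ≤ v ⬝ᵥ A *ᵥ v) : A.PosDef :=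
  .of_dotProduct_mulVec_pos hA fun v hv =>
    (mul_pos hμ (Matrix.dotProduct_star_self_pos_iff.2 hv)).trans_le (hcoer v)

theorem hasDerivAt_dotProduct {f g : ℝ → ι → ℝ} {f' g' : ι → ℝ} {t : ℝ} (hf : HasDerivAt f f' t)
    (hg : HasDerivAt g g' t) :
    HasDerivAt (fun τ => f τ ⬝ᵥ g τ) (f' ⬝ᵥ g t + f t ⬝ᵥ g') t :=
  (HasDerivAt.fun_sum fun i _ => (hasDerivAt_pi.1 hf i).mul (hasDerivAt_pi.1 hg i)).congr_deriv
    Finset.sum_add_distrib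

theorem hasDerivAt_mulVec (A : Matrix ι ι ℝ) {f : ℝ → ι → ℝ} {f' : ι → ℝ} {t : ℝ}
    (hf : HasDerivAt f f' t) : HasDerivAt (fun τ => A *ᵥ f τ) (A *ᵥ f') t :=
  (LinearMap.toContinuousLinearMap A.mulVecLin).hasFDerivAt.comp_hasDerivAt t hf

theorem absolutelyContinuousOnInterval_dotProduct {f g : ℝ → ι → ℝ} {a b : ℝ}
    (hf : ∀ i, AbsolutelyContinuousOnInterval (fun t => f t i) a b)
    (hg : ∀ i, AbsolutelyContinuousOnInterval (fun t => g t i) a b) :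
    AbsolutelyContinuousOnInterval (fun t => f t ⬝ᵥ g t) a b :=
  absolutelyContinuousOnInterval_finset_sum _ fun i _ => (hf i).fun_mul (hg i)

variable [DecidableEq ι] {A : Matrix ι ι ℝ}

theorem dotProduct_inv_mulVec_le (hA : A.PosDef) {μ : ℝ} (hμ : 0 < μ)
    (hcoer : ∀ v, μ * (v ⬝ᵥ v) ≤ v ⬝ᵥ A *ᵥ v) (v : ι → ℝ) :
    v ⬝ᵥ A⁻¹ *ᵥ v ≤ μ⁻¹ * (v ⬝ᵥ v) := by
  have hcoer_inv := hcoer (A⁻¹ *ᵥ v)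
  rw [Matrix.mulVec_mulVec, Matrix.mul_nonsing_inv A ((Matrix.isUnit_iff_isUnit_det A).1 hA.isUnit),
    Matrix.one_mulVec, dotProduct_comm _ v] at hcoer_inv
  have hsq := dotProduct_self_nonneg (v - μ • A⁻¹ *ᵥ v)
  simp only [sub_dotProduct, dotProduct_sub, smul_dotProduct, dotProduct_smul, smul_eq_mul,
    dotProduct_comm (A⁻¹ *ᵥ v) v] at hsq
  rw [inv_mul_eq_div, le_div_iff₀ hμ]
  nlinarith

/-- The Lyapunov function `q ⬝ A⁻¹ q + d ⬝ d` of the damped oscillator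
`q' = -(b/2) q - A d`, `d' = q - (b/2) d` with stiffness matrix `A`. -/
def oscEnergy (A : Matrix ι ι ℝ) (q d : ι → ℝ) : ℝ := q ⬝ᵥ A⁻¹ *ᵥ q + d ⬝ᵥ d

theorem oscEnergy_nonneg (hA : A.PosDef) (q d : ι → ℝ) : 0 ≤ oscEnergy A q d :=
  add_nonneg (by simpa using hA.inv.posSemidef.dotProduct_mulVec_nonneg q)
    (dotProduct_self_nonneg d)

theorem dotProduct_self_le_oscEnergy (hA : A.PosDef) (q d : ι → ℝ) : d ⬝ᵥ d ≤ oscEnergy A q d :=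
  le_add_of_nonneg_left (by simpa using hA.inv.posSemidef.dotProduct_mulVec_nonneg q)

theorem oscEnergy_le_of_coercive (hA : A.PosDef) {μ : ℝ} (hμ : 0 < μ)
    (hcoer : ∀ v, μ * (v ⬝ᵥ v) ≤ v ⬝ᵥ A *ᵥ v) (q d : ι → ℝ) :
    oscEnergy A q d ≤ μ⁻¹ * (q ⬝ᵥ q) + d ⬝ᵥ d :=
  add_le_add_left (dotProduct_inv_mulVec_le hA hμ hcoer q) _

theorem absolutelyContinuousOnInterval_oscEnergy (A : Matrix ι ι ℝ) {q d : ℝ → ι → ℝ} {a b : ℝ}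
    (hq : ∀ i, AbsolutelyContinuousOnInterval (fun t => q t i) a b)
    (hd : ∀ i, AbsolutelyContinuousOnInterval (fun t => d t i) a b) :
    AbsolutelyContinuousOnInterval (fun t => oscEnergy A (q t) (d t)) a b :=
  (absolutelyContinuousOnInterval_dotProduct hq fun i =>
    absolutelyContinuousOnInterval_finset_sum _ fun j _ => (hq j).const_mul (A⁻¹ i j)).fun_add
    (absolutelyContinuousOnInterval_dotProduct hd hd)

theorem hasDerivAt_oscEnergy (hA : A.PosDef) {q d : ℝ → ι → ℝ} {g ρ : ι → ℝ} {b t : ℝ}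
    (hq : HasDerivAt q (-(b / 2) • q t - A *ᵥ d t + g) t)
    (hd : HasDerivAt d (q t - (b / 2) • d t + ρ) t) :
    HasDerivAt (fun τ => oscEnergy A (q τ) (d τ))
      (-b * oscEnergy A (q t) (d t) + 2 * (g ⬝ᵥ A⁻¹ *ᵥ q t) + 2 * (ρ ⬝ᵥ d t)) t := by
  refine ((hasDerivAt_dotProduct hq (hasDerivAt_mulVec A⁻¹ hq)).add
    (hasDerivAt_dotProduct hd hd)).congr_deriv ?_
  have hcancel : (A *ᵥ d t) ⬝ᵥ A⁻¹ *ᵥ q t = q t ⬝ᵥ d t := by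
    rw [dotProduct_mulVec_comm hA.isHermitian.inv, Matrix.mulVec_mulVec,
      Matrix.nonsing_inv_mul A ((Matrix.isUnit_iff_isUnit_det A).1 hA.isUnit), Matrix.one_mulVec]
  rw [dotProduct_mulVec_comm hA.isHermitian.inv (q t), dotProduct_comm (d t)]
  simp only [add_dotProduct, sub_dotProduct, smul_dotProduct, hcancel, smul_eq_mul, oscEnergy]
  ring

theorem oscEnergy_young (hA : A.PosDef) {b : ℝ} (hb : 0 < b) (q d g ρ : ι → ℝ) :
    2 * (g ⬝ᵥ A⁻¹ *ᵥ q) + 2 * (ρ ⬝ᵥ d) ≤ b / 4 * oscEnergy A q d + 4 / b * oscEnergy A g ρ := by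
  have hsq := oscEnergy_nonneg hA ((b / 4) • q - g) ((b / 4) • d - ρ)
  simp only [oscEnergy, Matrix.mulVec_sub, Matrix.mulVec_smul, sub_dotProduct, dotProduct_sub,
    smul_dotProduct, dotProduct_smul, smul_eq_mul, dotProduct_mulVec_comm hA.isHermitian.inv q g,
    dotProduct_comm d ρ] at hsq ⊢
  refine sub_nonneg.1 ((mul_nonneg (by positivity : 0 ≤ 4 / b) hsq).trans_eq ?_)
  field_simp
  ring

theorem oscEnergy_le_of_forcing (hA : A.PosDef) {q d : ℝ → ι → ℝ} {b ε T : ℝ} (hb : 0 < b)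
    (hT : 0 ≤ T) (hε : 0 ≤ ε) (hqac : ∀ i, AbsolutelyContinuousOnInterval (fun t => q t i) 0 T)
    (hdac : ∀ i, AbsolutelyContinuousOnInterval (fun t => d t i) 0 T)
    (hforced : ∀ᵐ t, t ∈ Icc 0 T → ∃ g ρ, HasDerivAt q (-(b / 2) • q t - A *ᵥ d t + g) t ∧
      HasDerivAt d (q t - (b / 2) • d t + ρ) t ∧
      oscEnergy A g ρ ≤ ε * Real.exp (-(b / 2) * t)) :
    oscEnergy A (q T) (d T) ≤
      (oscEnergy A (q 0) (d 0) + 16 / b ^ 2 * ε) * Real.exp (-(b / 2) * T) := by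
  have hrate : b / 2 < 3 * b / 4 := by linarith
  have hdecay : oscEnergy A (q T) (d T) ≤ oscEnergy A (q 0) (d 0) * Real.exp (-(3 * b / 4) * T) +
      4 / b * ε / (3 * b / 4 - b / 2) *
        (Real.exp (-(b / 2) * T) - Real.exp (-(3 * b / 4) * T)) := by
    refine le_of_ae_deriv_add_mul_le_exp hrate hT
      (absolutelyContinuousOnInterval_oscEnergy A hqac hdac) ?_
    filter_upwards [hforced] with t ht htT
    obtain ⟨g, ρ, hq, hd, hgρ⟩ := ht htT
    rw [(hasDerivAt_oscEnergy hA hq hd).deriv]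
    have hyoung := oscEnergy_young hA hb (q t) (d t) g ρ
    have hforce := mul_le_mul_of_nonneg_left hgρ (by positivity : 0 ≤ 4 / b)
    linarith
  have hcoeff : 4 / b * ε / (3 * b / 4 - b / 2) = 16 / b ^ 2 * ε := by
    field_simp
    ring
  have hexp : Real.exp (-(3 * b / 4) * T) ≤ Real.exp (-(b / 2) * T) :=
    Real.exp_le_exp.2 (by nlinarith)
  have hfast := mul_le_mul_of_nonneg_left hexp (oscEnergy_nonneg hA (q 0) (d 0))
  have hdrop : 0 ≤ 16 / b ^ 2 * ε * Real.exp (-(3 * b / 4) * T) := by positivity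
  rw [hcoeff] at hdecay
  linarith

end ForcedOscillator

theorem hasDerivAt_relu_comp {u : ℝ → ℝ} {u' t s : ℝ} (hu : HasDerivAt u u' t)
    (hrelu : DifferentiableAt ℝ (fun τ => relu (u τ)) t) (hs : s ∈ reluSubdiff (u t)) :
    HasDerivAt (fun τ => relu (u τ)) (s * u') t := by
  obtain ⟨-, -, hpos, hneg⟩ := hs
  rcases lt_trichotomy (u t) 0 with hlt | hzero | hgt
  · rw [hneg hlt, zero_mul]
    refine (hasDerivAt_const t (0 : ℝ)).congr_of_eventuallyEq ?_
    filter_upwards [hu.continuousAt.eventually_lt continuousAt_const hlt] with τ hτ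
      using max_eq_right hτ.le
  · -- Both `relu ∘ u` and `relu ∘ u - u` are minimal at a kink, which forces `u' = 0`.
    have hrelu_zero : relu (u t) = 0 := by simp [hzero, relu]
    have hmin : IsLocalMin (fun τ => relu (u τ)) t :=
      .of_forall fun τ => hrelu_zero.trans_le (le_max_right _ _)
    have hmin_sub : IsLocalMin (fun τ => relu (u τ) - u τ) t := .of_forall fun τ => by
      change relu (u t) - u t ≤ relu (u τ) - u τ
      rw [hrelu_zero, hzero, sub_zero]
      exact sub_nonneg.2 (le_max_left _ _)
    have hderiv := hrelu.hasDerivAt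
    have hderiv_zero := hmin.hasDerivAt_eq_zero hderiv
    have hu' : u' = 0 := by
      linarith [hmin_sub.hasDerivAt_eq_zero (hderiv.sub hu)]
    rwa [hu', mul_zero, ← hderiv_zero]
  · rw [hpos hgt, one_mul]
    refine hu.congr_of_eventuallyEq ?_
    filter_upwards [continuousAt_const.eventually_lt hu.continuousAt hgt] with τ hτ
      using max_eq_left hτ.le

theorem abs_le_one_of_mem_reluSubdiff {z s : ℝ} (hs : s ∈ reluSubdiff z) : |s| ≤ 1 :=
  abs_le.2 ⟨by linarith [hs.1], hs.2.1⟩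

theorem reluDeriv_mem_reluSubdiff (z : ℝ) : reluDeriv z ∈ reluSubdiff z := by
  unfold reluDeriv
  split_ifs with hz
  · exact ⟨zero_le_one, le_rfl, fun _ => rfl, fun h => absurd hz h.not_ge⟩
  · exact ⟨le_rfl, zero_le_one, fun h => absurd h.le hz, fun _ => rfl⟩

theorem abs_sub_reluDeriv_le {z z₀ R s : ℝ} (hs : s ∈ reluSubdiff z) (hz : |z - z₀| ≤ R) :
    |s - reluDeriv z₀| ≤ if |z₀| ≤ R then 1 else 0 := by
  obtain ⟨hs_nonneg, hs_le, hpos, hneg⟩ := hs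
  obtain ⟨h₀_nonneg, h₀_le, hpos₀, hneg₀⟩ := reluDeriv_mem_reluSubdiff z₀
  obtain ⟨hlow, hhigh⟩ := abs_le.1 hz
  split_ifs with hR
  · exact abs_le.2 ⟨by linarith, by linarith⟩
  · have := (abs_nonneg _).trans hz
    rcases lt_abs.1 (not_le.1 hR) with h | h
    · rw [hpos (by linarith), hpos₀ (by linarith), sub_self, abs_zero]
    · rw [hneg (by linarith), hneg₀ (by linarith), sub_self, abs_zero]

theorem exists_lipschitzOnWith_of_hasDerivWithinAt {E : Type*} [NormedAddCommGroup E]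
    [NormedSpace ℝ E] {u v : ℝ → E} {a b : ℝ} (hv : ContinuousOn v (Icc a b))
    (hu : ∀ t ∈ Icc a b, HasDerivWithinAt u (v t) (Icc a b) t) :
    ∃ K, LipschitzOnWith K u (Icc a b) := by
  obtain ⟨C, hC⟩ := isCompact_Icc.exists_bound_of_continuousOn hv
  exact ⟨C.toNNReal, (convex_Icc a b).lipschitzOnWith_of_nnnorm_hasDerivWithin_le hu fun t ht =>
    NNReal.coe_le_coe.1 ((hC t ht).trans (Real.le_coe_toNNReal C))⟩

section GatedDynamics

open scoped Matrix

/-- The rate `m^{-1/2} ∑_r a_r s_{r,i} v_{r,i}` at which the network outputs change when the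
pre-activations move with velocity `v`. The gate `s r i` stands for `σ'` of neuron `r` on datum
`i`. -/
def gatedVelocity (a : Fin m → ℝ) (s v : Fin m → Fin n → ℝ) (i : Fin n) : ℝ :=
  1 / √(m : ℝ) * ∑ r, a r * (s r i * v r i)

/-- The gradient force which the residual `d` exerts on the pre-activations, for data with Gram
matrix `k` and gates `s`. -/
def gatedForce (k : Matrix (Fin n) (Fin n) ℝ) (a : Fin m → ℝ) (s : Fin m → Fin n → ℝ)
    (d : Fin n → ℝ) (r : Fin m) (i : Fin n) : ℝ :=
  ∑ j, d j * (1 / √(m : ℝ) * a r * s r j * k i j)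

/-- The neural tangent kernel of data with Gram matrix `k`, with separate gates for the rows and
the columns. -/
def gatedKernel (k : Matrix (Fin n) (Fin n) ℝ) (s s' : Fin m → Fin n → ℝ) :
    Matrix (Fin n) (Fin n) ℝ :=
  .of fun i j => k i j * (1 / (m : ℝ) * ∑ r, s r i * s' r j)

theorem gatedVelocity_sub_left (a : Fin m → ℝ) (s s' v : Fin m → Fin n → ℝ) :
    gatedVelocity a (s - s') v = gatedVelocity a s v - gatedVelocity a s' v := by
  ext i
  simp only [gatedVelocity, Pi.sub_apply, sub_mul, mul_sub, Finset.sum_sub_distrib]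

theorem gatedVelocity_sub_right (a : Fin m → ℝ) (s v v' : Fin m → Fin n → ℝ) :
    gatedVelocity a s (v - v') = gatedVelocity a s v - gatedVelocity a s v' := by
  ext i
  simp only [gatedVelocity, Pi.sub_apply, mul_sub, Finset.sum_sub_distrib]

theorem gatedVelocity_smul_right (a : Fin m → ℝ) (s v : Fin m → Fin n → ℝ) (c : ℝ) :
    gatedVelocity a s (c • v) = c • gatedVelocity a s v := by
  ext i
  simp only [gatedVelocity, Pi.smul_apply, smul_eq_mul, mul_left_comm _ c, ← Finset.mul_sum]

theorem hasDerivAt_gatedVelocity (a : Fin m → ℝ) (s : Fin m → Fin n → ℝ)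
    {v : ℝ → Fin m → Fin n → ℝ} {v' : Fin m → Fin n → ℝ} {t : ℝ} (hv : HasDerivAt v v' t) :
    HasDerivAt (fun τ => gatedVelocity a s (v τ)) (gatedVelocity a s v') t :=
  hasDerivAt_pi.2 fun i => .const_mul _ <| .fun_sum fun r _ =>
    ((hasDerivAt_pi.1 (hasDerivAt_pi.1 hv r) i).const_mul _).const_mul _

theorem absolutelyContinuousOnInterval_gatedVelocity (a : Fin m → ℝ) (s : Fin m → Fin n → ℝ)
    {v : ℝ → Fin m → Fin n → ℝ} {c d : ℝ}
    (hv : ∀ r i, AbsolutelyContinuousOnInterval (fun t => v t r i) c d) (i : Fin n) :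
    AbsolutelyContinuousOnInterval (fun t => gatedVelocity a s (v t) i) c d :=
  (absolutelyContinuousOnInterval_finset_sum _ fun r _ =>
    ((hv r i).const_mul _).const_mul _).const_mul _

theorem gatedKernel_sub_right (k : Matrix (Fin n) (Fin n) ℝ) (s s' s'' : Fin m → Fin n → ℝ) :
    gatedKernel k s (s' - s'') = gatedKernel k s s' - gatedKernel k s s'' := by
  ext i j
  simp only [gatedKernel, Matrix.of_apply, Matrix.sub_apply, Pi.sub_apply, mul_sub,
    Finset.sum_sub_distrib]

theorem isHermitian_gatedKernel {k : Matrix (Fin n) (Fin n) ℝ} (hk : k.IsHermitian)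
    (s : Fin m → Fin n → ℝ) : (gatedKernel k s s).IsHermitian :=
  .ext fun i j => by
    simp only [gatedKernel, Matrix.of_apply, star_trivial, mul_comm (s _ i), ← hk.apply i j]

theorem one_div_sqrt_mul_self (m : ℕ) : 1 / √(m : ℝ) * (1 / √(m : ℝ)) = 1 / (m : ℝ) := by
  rw [div_mul_div_comm, one_mul, Real.mul_self_sqrt m.cast_nonneg]

theorem gatedVelocity_gatedForce (k : Matrix (Fin n) (Fin n) ℝ) {a : Fin m → ℝ}
    (ha : ∀ r, |a r| = 1) (s s' : Fin m → Fin n → ℝ) (d : Fin n → ℝ) :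
    gatedVelocity a s (gatedForce k a s' d) = gatedKernel k s s' *ᵥ d := by
  have ha_sq : ∀ r, a r * a r = 1 := fun r => by rw [← abs_mul_abs_self, ha r, one_mul]
  ext i
  simp only [gatedVelocity, gatedForce, gatedKernel, Matrix.mulVec, dotProduct, Matrix.of_apply,
    Finset.mul_sum, Finset.sum_mul]
  rw [Finset.sum_comm]
  refine Finset.sum_congr rfl fun j _ => Finset.sum_congr rfl fun r _ => ?_
  rw [← one_div_sqrt_mul_self]
  linear_combination
    (1 / √(m : ℝ) * (1 / √(m : ℝ)) * s r i * s' r j * k i j * d j) * ha_sq r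

end GatedDynamics

section PreactivationFlow

/-- The pre-activations `⟪w_r, x_i⟫` of a family of weights. -/
def preact (x : Fin n → EuclideanSpace ℝ (Fin p)) : Weights m p →L[ℝ] Fin m → Fin n → ℝ :=
  .pi fun r => .pi fun i => (innerSL ℝ (x i)).comp (.proj r)

theorem preact_apply (x : Fin n → EuclideanSpace ℝ (Fin p)) (W : Weights m p) (r : Fin m)
    (i : Fin n) : preact x W r i = inner ℝ (W r) (x i) := by
  simp [preact, real_inner_comm]

/-- A heavy ball trajectory expressed through its pre-activations `u`, their velocities `v` and
the residual `d`. The data enter only through their Gram matrix `k`. -/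
structure IsPreactivationFlow (k : Matrix (Fin n) (Fin n) ℝ) (a : Fin m → ℝ) (b : ℝ)
    (u v : ℝ → Fin m → Fin n → ℝ) (d : ℝ → Fin n → ℝ) : Prop where
  velocity_zero : v 0 = 0
  hasDerivWithinAt_preact : ∀ t, 0 ≤ t → HasDerivWithinAt u (v t) (Ici 0) t
  absolutelyContinuous_velocity :
    ∀ r i T, 0 ≤ T → AbsolutelyContinuousOnInterval (fun t => v t r i) 0 T
  absolutelyContinuous_residual :
    ∀ i T, 0 ≤ T → AbsolutelyContinuousOnInterval (fun t => d t i) 0 T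
  ae_hasDerivAt : ∀ᵐ t : ℝ, 0 ≤ t → ∃ s : Fin m → Fin n → ℝ,
    (∀ r i, s r i ∈ reluSubdiff (u t r i)) ∧
    HasDerivAt v (-b • v t - gatedForce k a s (d t)) t ∧
    HasDerivAt d (gatedVelocity a s (v t)) t

theorem ae_nonneg_of_forall_ae_Icc {P : ℝ → Prop}
    (h : ∀ T, 0 ≤ T → ∀ᵐ t : ℝ, t ∈ Icc 0 T → P t) : ∀ᵐ t : ℝ, 0 ≤ t → P t := by
  filter_upwards [ae_all_iff.2 fun N : ℕ => h N N.cast_nonneg] with t ht ht_nonneg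
  obtain ⟨N, hN⟩ := exists_nat_ge t
  exact ht N ⟨ht_nonneg, hN⟩

section IntegralEquation

variable {E : Type*} [NormedAddCommGroup E] [NormedSpace ℝ E] [CompleteSpace E] {V F : ℝ → E}

theorem ae_hasDerivAt_of_eq_neg_integral (hF : ∀ t, 0 ≤ t → IntervalIntegrable F volume 0 t)
    (hV : ∀ t, 0 ≤ t → V t = -∫ s in (0 : ℝ)..t, F s) :
    ∀ᵐ t : ℝ, 0 ≤ t → HasDerivAt V (-F t) t := by
  refine ae_nonneg_of_forall_ae_Icc fun T hT => ?_
  have hne : ∀ᵐ t : ℝ, t ≠ 0 := by simp [ae_iff]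
  filter_upwards [(hF T hT).ae_hasDerivAt_integral, hne] with t ht ht_ne htT
  rw [uIcc_of_le hT] at ht
  refine (ht htT 0 (left_mem_Icc.2 hT)).neg.congr_of_eventuallyEq ?_
  filter_upwards [Ioi_mem_nhds (htT.1.lt_of_ne' ht_ne)] with τ hτ using hV τ hτ.le

theorem absolutelyContinuousOnInterval_of_eq_neg_integral (L : E →L[ℝ] ℝ)
    (hF : ∀ t, 0 ≤ t → IntervalIntegrable F volume 0 t)
    (hV : ∀ t, 0 ≤ t → V t = -∫ s in (0 : ℝ)..t, F s) {T : ℝ} (hT : 0 ≤ T) :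
    AbsolutelyContinuousOnInterval (fun t => L (V t)) 0 T := by
  have hLF : IntervalIntegrable (fun s => L (F s)) volume 0 T :=
    ⟨L.integrable_comp (hF T hT).1, L.integrable_comp (hF T hT).2⟩
  refine absolutelyContinuousOnInterval_congr
    (hLF.absolutelyContinuousOnInterval_intervalIntegral left_mem_uIcc).fun_neg fun t ht => ?_
  rw [uIcc_of_le hT] at ht
  rw [hV t ht.1, map_neg, L.intervalIntegral_comp_comm (hF t ht.1)]

end IntegralEquation

variable {x : Fin n → EuclideanSpace ℝ (Fin p)} {y : Fin n → ℝ} {a : Fin m → ℝ} {b : ℝ}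
  {W₀ : Weights m p} {W V : ℝ → Weights m p}

theorem preact_of_mem_lossGenGrad {G W : Weights m p} (hG : G ∈ lossGenGrad x y a W) :
    ∃ s : Fin m → Fin n → ℝ, (∀ r i, s r i ∈ reluSubdiff (preact x W r i)) ∧
      preact x G = gatedForce (Matrix.gram ℝ x) a s (err x y a W) := by
  obtain ⟨s, hs, hGs⟩ := hG
  refine ⟨s, fun r i => preact_apply x W r i ▸ hs r i, ?_⟩
  ext r i
  rw [preact_apply, hGs, sum_inner]
  simp only [real_inner_smul_left, gatedForce, Matrix.gram_apply, real_inner_comm (x _) (x i)]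

theorem absolutelyContinuousOnInterval_relu_preact (hV : ContinuousOn V (Ici 0))
    (hW : ∀ t, 0 ≤ t → HasDerivWithinAt W (V t) (Ici 0) t) (r : Fin m) (i : Fin n) {T : ℝ}
    (hT : 0 ≤ T) : AbsolutelyContinuousOnInterval (fun t => relu (preact x (W t) r i)) 0 T := by
  obtain ⟨K, hK⟩ := exists_lipschitzOnWith_of_hasDerivWithinAt
    (hV.mono Icc_subset_Ici_self : ContinuousOn V (Icc 0 T)) fun t ht =>
      (hW t ht.1).mono Icc_subset_Ici_self
  have hrelu : LipschitzWith 1 relu := LipschitzWith.id.max_const 0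
  rw [← uIcc_of_le hT] at hK
  exact ((hrelu.comp ((ContinuousLinearMap.proj (R := ℝ) i).comp
    ((ContinuousLinearMap.proj r).comp (preact x))).lipschitz).comp_lipschitzOnWith
      hK).absolutelyContinuousOnInterval

theorem err_eq_preact (W : Weights m p) (i : Fin n) :
    err x y a W i = 1 / √(m : ℝ) * ∑ r, a r * relu (preact x W r i) - y i := by
  simp only [err, net, preact_apply]

theorem hasDerivAt_err {t : ℝ} {s : Fin m → Fin n → ℝ}
    (hW : HasDerivAt W (V t) t) (hs : ∀ r i, s r i ∈ reluSubdiff (preact x (W t) r i))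
    (hrelu : ∀ r i, DifferentiableAt ℝ (fun τ => relu (preact x (W τ) r i)) t) :
    HasDerivAt (fun τ => err x y a (W τ)) (gatedVelocity a s (preact x (V t))) t := by
  refine hasDerivAt_pi.2 fun i => ?_
  have hpreact := fun r => hasDerivAt_pi.1 (hasDerivAt_pi.1
    ((preact x).hasFDerivAt.comp_hasDerivAt t hW) r) i
  simp only [err_eq_preact]
  exact .sub_const _ <| .const_mul _ <| .fun_sum fun r _ =>
    (hasDerivAt_relu_comp (hpreact r) (hrelu r i) (hs r i)).const_mul (a r)

theorem IsHBFlow.exists_isPreactivationFlow (h : IsHBFlow x y a b W₀ W) :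
    ∃ v, IsPreactivationFlow (Matrix.gram ℝ x) a b (fun t => preact x (W t)) v
      (fun t => err x y a (W t)) := by
  obtain ⟨-, V, G, hVcont, hW, hG, hGmem, hV⟩ := h
  have hF : ∀ t, 0 ≤ t → IntervalIntegrable (fun s => b • V s + G s) volume 0 t := fun t ht =>
    ((hVcont.mono (by rw [uIcc_of_le ht]; exact Icc_subset_Ici_self)).intervalIntegrable.smul
      b).add (hG t ht)
  refine ⟨fun t => preact x (V t), ?_, fun t ht => ?_, fun r i T hT => ?_, fun i T hT => ?_, ?_⟩
  · simp [hV 0 le_rfl]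
  · exact (preact x).hasFDerivAt.comp_hasDerivWithinAt t (hW t ht)
  · exact absolutelyContinuousOnInterval_of_eq_neg_integral
      ((ContinuousLinearMap.proj i).comp ((ContinuousLinearMap.proj r).comp (preact x))) hF hV hT
  · simp only [err_eq_preact]
    exact ((absolutelyContinuousOnInterval_finset_sum _ fun r _ =>
      (absolutelyContinuousOnInterval_relu_preact hVcont hW r i hT).const_mul _).const_mul
        _).fun_sub (absolutelyContinuousOnInterval_const _ _ _)
  · have hrelu : ∀ᵐ t : ℝ, 0 ≤ t → ∀ r i,
        DifferentiableAt ℝ (fun τ => relu (preact x (W τ) r i)) t :=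
      ae_nonneg_of_forall_ae_Icc fun T hT => by
        filter_upwards [ae_all_iff.2 fun r => ae_all_iff.2 fun i =>
          (absolutelyContinuousOnInterval_relu_preact hVcont hW r i hT).ae_differentiableAt]
          with t ht htT r i using ht r i (by rwa [uIcc_of_le hT])
    have hne : ∀ᵐ t : ℝ, t ≠ 0 := by simp [ae_iff]
    filter_upwards [hrelu, ae_hasDerivAt_of_eq_neg_integral hF hV, hGmem, hne]
      with t htrelu htV htG ht_ne ht
    obtain ⟨s, hs, hGs⟩ := preact_of_mem_lossGenGrad (htG ht)
    refine ⟨s, hs, ?_, hasDerivAt_err ((hW t ht).hasDerivAt (Ici_mem_nhds (ht.lt_of_ne' ht_ne)))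
      hs (htrelu ht)⟩
    refine ((preact x).hasFDerivAt.comp_hasDerivAt t (htV ht)).congr_deriv ?_
    rw [map_neg, map_add, map_smul, hGs, neg_add, neg_smul, sub_eq_add_neg]

end PreactivationFlow

section DotProduct

open scoped Matrix

variable {ι : Type*} [Fintype ι] {z : ι → ℝ} {c : ℝ}

theorem sum_abs_le_sqrt_card_mul (h : z ⬝ᵥ z ≤ c) : ∑ i, |z i| ≤ √(Fintype.card ι * c) := by
  refine Real.le_sqrt_of_sq_le ?_
  have hcs := sq_sum_le_card_mul_sum_sq (s := Finset.univ) (f := fun i => |z i|)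
  simp only [sq_abs, Finset.card_univ] at hcs
  refine hcs.trans (mul_le_mul_of_nonneg_left ?_ (Nat.cast_nonneg _))
  simpa only [dotProduct, ← sq] using h

theorem abs_apply_le_sqrt (h : z ⬝ᵥ z ≤ c) (i : ι) : |z i| ≤ √c :=
  Real.abs_le_sqrt <| ((sq (z i)).trans_le (Finset.single_le_sum
    (fun j _ => mul_self_nonneg (z j)) (Finset.mem_univ i))).trans h

theorem dotProduct_self_le_sq_sum_abs (z : ι → ℝ) : z ⬝ᵥ z ≤ (∑ i, |z i|) ^ 2 := by
  simpa only [dotProduct, ← sq, sq_abs] using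
    Finset.sum_sq_le_sq_sum_of_nonneg (s := Finset.univ) fun i _ => abs_nonneg (z i)

theorem dotProduct_self_le_card_mul_sq (h : ∀ i, |z i| ≤ c) : z ⬝ᵥ z ≤ Fintype.card ι * c ^ 2 := by
  have hsum : z ⬝ᵥ z ≤ ∑ _i : ι, c ^ 2 := Finset.sum_le_sum fun i _ => by
    rw [← sq, ← sq_abs]
    exact pow_le_pow_left₀ (abs_nonneg _) (h i) 2
  simpa using hsum

theorem dotProduct_self_sub_le (z w : ι → ℝ) :
    (z - w) ⬝ᵥ (z - w) ≤ 2 * (z ⬝ᵥ z + w ⬝ᵥ w) := by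
  have hnonneg := dotProduct_self_nonneg (z + w)
  simp only [add_dotProduct, dotProduct_add, sub_dotProduct, dotProduct_sub] at hnonneg ⊢
  linarith

theorem abs_dotProduct_mulVec_le (A : Matrix ι ι ℝ) (z : ι → ℝ) :
    |z ⬝ᵥ A *ᵥ z| ≤ √(∑ i, ∑ j, A i j ^ 2) * (z ⬝ᵥ z) := by
  have hpairs : z ⬝ᵥ A *ᵥ z = ∑ ij : ι × ι, A ij.1 ij.2 * (z ij.1 * z ij.2) := by
    simp only [dotProduct, Matrix.mulVec, Finset.mul_sum, Fintype.sum_prod_type]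
    exact Finset.sum_congr rfl fun i _ => Finset.sum_congr rfl fun j _ => by ring
  have hsq : ∑ ij : ι × ι, (z ij.1 * z ij.2) ^ 2 = (z ⬝ᵥ z) ^ 2 := by
    rw [Fintype.sum_prod_type, sq, dotProduct, Finset.sum_mul_sum]
    exact Finset.sum_congr rfl fun i _ => Finset.sum_congr rfl fun j _ => by ring
  have hcs := Finset.sum_mul_sq_le_sq_mul_sq Finset.univ
    (fun ij : ι × ι => A ij.1 ij.2) (fun ij => z ij.1 * z ij.2)
  rw [← hpairs, hsq, Fintype.sum_prod_type] at hcs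
  refine (Real.abs_le_sqrt hcs).trans_eq ?_
  rw [Real.sqrt_mul' _ (sq_nonneg _), Real.sqrt_sq (dotProduct_self_nonneg z)]

theorem coercive_of_sum_sq_sub_le {A B : Matrix ι ι ℝ} {lam ε : ℝ} (hε : 0 ≤ ε)
    (hA : ∀ z, lam * (z ⬝ᵥ z) ≤ z ⬝ᵥ A *ᵥ z)
    (hAB : ∑ i, ∑ j, (B i j - A i j) ^ 2 ≤ ε ^ 2) (z : ι → ℝ) :
    (lam - ε) * (z ⬝ᵥ z) ≤ z ⬝ᵥ B *ᵥ z := by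
  have hdiff := (abs_le.1 (abs_dotProduct_mulVec_le (B - A) z)).1
  rw [Matrix.sub_mulVec, dotProduct_sub] at hdiff
  have hfrob : √(∑ i, ∑ j, (B - A) i j ^ 2) * (z ⬝ᵥ z) ≤ ε * (z ⬝ᵥ z) :=
    mul_le_mul_of_nonneg_right (Real.sqrt_le_iff.2 ⟨hε, hAB⟩) (dotProduct_self_nonneg z)
  linarith [hA z]

theorem sInf_spectrum_mul_dotProduct_le [DecidableEq ι] {A : Matrix ι ι ℝ} (hA : A.IsHermitian)
    (z : ι → ℝ) : sInf (spectrum ℝ A) * (z ⬝ᵥ z) ≤ z ⬝ᵥ A *ᵥ z := by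
  have hbdd : BddBelow (spectrum ℝ A) := by
    rw [hA.spectrum_real_eq_range_eigenvalues]
    exact (finite_range _).bddBelow
  have hpsd : (A - algebraMap ℝ _ (sInf (spectrum ℝ A))).PosSemidef := by
    refine Matrix.posSemidef_iff_isHermitian_and_spectrum_nonneg.2 ⟨hA.sub ?_, ?_⟩
    · rw [Algebra.algebraMap_eq_smul_one]
      exact Matrix.isHermitian_one.smul (IsSelfAdjoint.all _)
    · rw [← spectrum.sub_singleton_eq]
      rintro _ ⟨μ, hμ, _, rfl, rfl⟩
      exact sub_nonneg.2 (csInf_le hbdd hμ)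
  have hnonneg := hpsd.dotProduct_mulVec_nonneg z
  rwa [star_trivial, Matrix.sub_mulVec, dotProduct_sub, Algebra.algebraMap_eq_smul_one,
    Matrix.smul_mulVec, Matrix.one_mulVec, dotProduct_smul, smul_eq_mul, sub_nonneg] at hnonneg

end DotProduct

section LazyRegime

open scoped Matrix

variable {k : Matrix (Fin n) (Fin n) ℝ} {a : Fin m → ℝ} {b R c t : ℝ}
  {v : ℝ → Fin m → Fin n → ℝ} {d : ℝ → Fin n → ℝ} {s s₀ σ w u₀ u₁ : Fin m → Fin n → ℝ}
  {z : Fin n → ℝ}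

theorem abs_gatedForce_le (ha : ∀ r, |a r| = 1) (hk : ∀ i j, |k i j| ≤ 1)
    (hs : ∀ r i, |s r i| ≤ 1) (h : z ⬝ᵥ z ≤ c) (r : Fin m) (i : Fin n) :
    |gatedForce k a s z r i| ≤ √(n * c) / √m := by
  calc |gatedForce k a s z r i| ≤ ∑ j, |z j| * (1 / √m) := by
        refine (Finset.abs_sum_le_sum_abs _ _).trans (Finset.sum_le_sum fun j _ => ?_)
        rw [abs_mul, abs_mul, abs_mul, abs_mul, ha r, mul_one,
          abs_of_nonneg (by positivity : 0 ≤ 1 / √(m : ℝ)), mul_assoc (1 / √(m : ℝ))]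
        exact mul_le_mul_of_nonneg_left (mul_le_of_le_one_right (by positivity)
          (mul_le_one₀ (hs r j) (abs_nonneg _) (hk i j))) (abs_nonneg _)
    _ ≤ √(n * c) / √m := by
        rw [← Finset.sum_mul, mul_one_div]
        gcongr
        simpa only [Fintype.card_fin] using sum_abs_le_sqrt_card_mul h

theorem dotProduct_gatedVelocity_le (ha : ∀ r, |a r| = 1) (hw : ∀ r i, |w r i| ≤ c) :
    gatedVelocity a σ w ⬝ᵥ gatedVelocity a σ w ≤
      (1 / √m * ((∑ i, ∑ r, |σ r i|) * c)) ^ 2 := by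
  refine (dotProduct_self_le_sq_sum_abs _).trans
    (pow_le_pow_left₀ (Finset.sum_nonneg fun _ _ => abs_nonneg _) ?_ 2)
  simp only [Finset.sum_mul, Finset.mul_sum]
  refine Finset.sum_le_sum fun i _ => ?_
  rw [gatedVelocity, abs_mul, abs_of_nonneg (by positivity : 0 ≤ 1 / √(m : ℝ)), ← Finset.mul_sum]
  refine mul_le_mul_of_nonneg_left ?_ (by positivity)
  refine (Finset.abs_sum_le_sum_abs _ _).trans (Finset.sum_le_sum fun r _ => ?_)
  rw [abs_mul, abs_mul, ha r, one_mul]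
  exact mul_le_mul_of_nonneg_left (hw r i) (abs_nonneg _)

theorem dotProduct_gatedKernel_mulVec_le (hk : ∀ i j, |k i j| ≤ 1) (hs : ∀ r i, |s r i| ≤ 1)
    (hz : ∀ j, |z j| ≤ c) :
    (gatedKernel k s σ *ᵥ z) ⬝ᵥ gatedKernel k s σ *ᵥ z ≤
      n * ((∑ i, ∑ r, |σ r i|) / m * c) ^ 2 := by
  refine (dotProduct_self_le_card_mul_sq fun i => ?_).trans_eq (by rw [Fintype.card_fin])
  rw [Matrix.mulVec, dotProduct, Finset.sum_div, Finset.sum_mul]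
  refine (Finset.abs_sum_le_sum_abs _ _).trans (Finset.sum_le_sum fun j _ => ?_)
  rw [abs_mul]
  refine mul_le_mul ?_ (hz j) (abs_nonneg _) (by positivity)
  rw [gatedKernel, Matrix.of_apply, abs_mul, abs_mul,
    abs_of_nonneg (by positivity : 0 ≤ 1 / (m : ℝ)), one_div_mul_eq_div]
  refine (mul_le_of_le_one_left (by positivity) (hk i j)).trans ?_
  gcongr
  refine (Finset.abs_sum_le_sum_abs _ _).trans (Finset.sum_le_sum fun r _ => ?_)
  rw [abs_mul]
  exact mul_le_of_le_one_left (abs_nonneg _) (hs r i)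

/-- The activation pattern `σ'(u)` of the pre-activations `u`. -/
def gates (u : Fin m → Fin n → ℝ) : Fin m → Fin n → ℝ := fun r i => reluDeriv (u r i)

/-- The number of pre-activations within distance `R` of the kink of ReLU. -/
def nearKinkCount (R : ℝ) (u : Fin m → Fin n → ℝ) : ℝ :=
  ∑ i, ∑ r, if |u r i| ≤ R then 1 else 0

theorem nearKinkCount_nonneg (R : ℝ) (u : Fin m → Fin n → ℝ) : 0 ≤ nearKinkCount R u :=
  Finset.sum_nonneg fun _ _ => Finset.sum_nonneg fun _ _ => by split_ifs <;> norm_num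

theorem abs_gates_le_one (u : Fin m → Fin n → ℝ) (r : Fin m) (i : Fin n) : |gates u r i| ≤ 1 :=
  abs_le_one_of_mem_reluSubdiff (reluDeriv_mem_reluSubdiff _)

theorem sum_abs_sub_gates_le_nearKinkCount (hs : ∀ r i, s r i ∈ reluSubdiff (u₁ r i))
    (hu : ‖u₁ - u₀‖ ≤ R) : ∑ i, ∑ r, |(s - gates u₀) r i| ≤ nearKinkCount R u₀ :=
  Finset.sum_le_sum fun i _ => Finset.sum_le_sum fun r _ => abs_sub_reluDeriv_le (hs r i) <|
    ((norm_le_pi_norm ((u₁ - u₀) r) i).trans (norm_le_pi_norm (u₁ - u₀) r)).trans hu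

/-- The momentum variable `q` for which the equations of motion with gates frozen at `s₀` become
the damped oscillator of `oscEnergy`. -/
def frozenMomentum (a : Fin m → ℝ) (b : ℝ) (s₀ v : Fin m → Fin n → ℝ) (d : Fin n → ℝ) :
    Fin n → ℝ :=
  gatedVelocity a s₀ v + (b / 2) • d

/-- The stiffness matrix of the damped oscillator obtained by freezing the gates at `s₀`. -/
def frozenStiffness (k : Matrix (Fin n) (Fin n) ℝ) (b : ℝ) (s₀ : Fin m → Fin n → ℝ) :
    Matrix (Fin n) (Fin n) ℝ :=
  gatedKernel k s₀ s₀ - (b ^ 2 / 4) • (1 : Matrix (Fin n) (Fin n) ℝ)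

/-- The forcing of the frozen momentum when the actual gates are `s` instead of `s₀`. -/
def gateForcing (k : Matrix (Fin n) (Fin n) ℝ) (a : Fin m → ℝ) (b : ℝ)
    (s₀ s v : Fin m → Fin n → ℝ) (d : Fin n → ℝ) : Fin n → ℝ :=
  (b / 2) • gatedVelocity a (s - s₀) v - gatedKernel k s₀ (s - s₀) *ᵥ d

theorem gatedVelocity_eq_frozenMomentum (a : Fin m → ℝ) (b : ℝ) (s₀ s v : Fin m → Fin n → ℝ)
    (d : Fin n → ℝ) : gatedVelocity a s v =
      frozenMomentum a b s₀ v d - (b / 2) • d + gatedVelocity a (s - s₀) v := by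
  rw [gatedVelocity_sub_left, frozenMomentum]
  abel

theorem hasDerivAt_frozenMomentum (ha : ∀ r, |a r| = 1)
    (hv : HasDerivAt v (-b • v t - gatedForce k a s (d t)) t)
    (hd : HasDerivAt d (gatedVelocity a s (v t)) t) :
    HasDerivAt (fun τ => frozenMomentum a b s₀ (v τ) (d τ))
      (-(b / 2) • frozenMomentum a b s₀ (v t) (d t) - frozenStiffness k b s₀ *ᵥ d t +
        gateForcing k a b s₀ s (v t) (d t)) t := by
  refine ((hasDerivAt_gatedVelocity a s₀ hv).add (hd.const_smul (b / 2))).congr_deriv ?_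
  rw [gatedVelocity_sub_right, gatedVelocity_smul_right, gatedVelocity_gatedForce k ha, gateForcing,
    gatedKernel_sub_right, gatedVelocity_sub_left, frozenStiffness, frozenMomentum,
    Matrix.sub_mulVec, Matrix.sub_mulVec, Matrix.smul_mulVec, Matrix.one_mulVec]
  module

theorem coercive_frozenStiffness
    (hcoer : ∀ z, 7 / 16 * b ^ 2 * (z ⬝ᵥ z) ≤ z ⬝ᵥ gatedKernel k s₀ s₀ *ᵥ z) (z : Fin n → ℝ) :
    3 / 16 * b ^ 2 * (z ⬝ᵥ z) ≤ z ⬝ᵥ frozenStiffness k b s₀ *ᵥ z := by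
  rw [frozenStiffness, Matrix.sub_mulVec, Matrix.smul_mulVec, Matrix.one_mulVec, dotProduct_sub,
    dotProduct_smul, smul_eq_mul]
  linarith [hcoer z]

theorem isHermitian_frozenStiffness (hk : k.IsHermitian) (b : ℝ) (s₀ : Fin m → Fin n → ℝ) :
    (frozenStiffness k b s₀).IsHermitian :=
  (isHermitian_gatedKernel hk s₀).sub (Matrix.isHermitian_one.smul (IsSelfAdjoint.all _))

/-- The lazy training regime for Gram matrix `k`, friction `b` and initial pre-activations `u₀`:
as long as the squared residual is at most `c e^{-bt/2}`, no pre-activation travels further than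
`R`, too few of them start within `R` of a kink for the gates to matter, and the initial kernel is
coercive. For `b = √(2 λ)` the last condition says that the kernel keeps curvature `(7 / 8) λ`. -/
structure IsLazyRegime (k : Matrix (Fin n) (Fin n) ℝ) (a : Fin m → ℝ) (b R c : ℝ)
    (u₀ : Fin m → Fin n → ℝ) : Prop where
  width_pos : 0 < m
  abs_sign : ∀ r, |a r| = 1
  gram_isHermitian : k.IsHermitian
  abs_gram_le : ∀ i j, |k i j| ≤ 1
  friction_pos : 0 < b
  coercive : ∀ z, 7 / 16 * b ^ 2 * (z ⬝ᵥ z) ≤ z ⬝ᵥ gatedKernel k (gates u₀) (gates u₀) *ᵥ z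
  travel_le : 16 / (3 * b ^ 2) * (√(n * c) / √m) ≤ R
  nearKink_le : n * (nearKinkCount R u₀ / m) ^ 2 ≤ b ^ 4 / 1024

theorem IsLazyRegime.mono {c' : ℝ} (h : IsLazyRegime k a b R c u₀) (hc : c' ≤ c) :
    IsLazyRegime k a b R c' u₀ where
  __ := h
  travel_le := by
    refine le_trans ?_ h.travel_le
    gcongr

theorem IsLazyRegime.posDef_frozenStiffness (h : IsLazyRegime k a b R c u₀) :
    (frozenStiffness k b (gates u₀)).PosDef :=
  posDef_of_coercive (isHermitian_frozenStiffness h.gram_isHermitian b _)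
    (by have := h.friction_pos; positivity) (coercive_frozenStiffness h.coercive)

theorem sqrt_mul_exp (c b t : ℝ) :
    √(c * Real.exp (-(b / 2) * t)) = √c * Real.exp (-(b / 4) * t) := by
  rw [Real.sqrt_mul' _ (Real.exp_pos _).le, ← Real.exp_half]
  ring_nf

end LazyRegime

section LinearConvergence

open scoped Matrix

variable {k : Matrix (Fin n) (Fin n) ℝ} {a : Fin m → ℝ} {b R c E T : ℝ}
  {u v : ℝ → Fin m → Fin n → ℝ} {d : ℝ → Fin n → ℝ} {s w u₀ u₁ : Fin m → Fin n → ℝ}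
  {z : Fin n → ℝ}

theorem IsPreactivationFlow.abs_velocity_le (hflow : IsPreactivationFlow k a b u v d)
    (h : IsLazyRegime k a b R c u₀) (hT : 0 ≤ T)
    (hd : ∀ t ∈ Icc 0 T, d t ⬝ᵥ d t ≤ c * Real.exp (-(b / 2) * t)) (r : Fin m) (i : Fin n) :
    |v T r i| ≤ 4 / (3 * b) * (√(n * c) / √m) * Real.exp (-(b / 4) * T) := by
  have hb := h.friction_pos
  have hforce : ∀ᵐ t, t ∈ Icc 0 T → |deriv (fun τ => v τ r i) t + b * v t r i| ≤
      √(n * c) / √m * Real.exp (-(b / 4) * t) := by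
    filter_upwards [hflow.ae_hasDerivAt] with t ht htT
    obtain ⟨s, hs, hv, -⟩ := ht htT.1
    have hvi : HasDerivAt (fun τ => v τ r i) _ t := hasDerivAt_pi.1 (hasDerivAt_pi.1 hv r) i
    have hbound := abs_gatedForce_le h.abs_sign h.abs_gram_le
      (fun r i => abs_le_one_of_mem_reluSubdiff (hs r i)) (hd t htT) r i
    rw [← mul_assoc, sqrt_mul_exp, mul_div_right_comm] at hbound
    rw [hvi.deriv]
    have hcancel : (-b • v t - gatedForce k a s (d t)) r i + b * v t r i =
        -gatedForce k a s (d t) r i := by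
      simp only [Pi.sub_apply, Pi.smul_apply, smul_eq_mul]
      ring
    rwa [hcancel, abs_neg]
  refine (abs_le_of_ae_abs_deriv_add_mul_le_exp (by linarith) hT (by positivity)
    (hflow.absolutelyContinuous_velocity r i T hT) (by simp [hflow.velocity_zero])
    hforce).trans_eq ?_
  field_simp
  ring

theorem IsPreactivationFlow.norm_preact_sub_le (hflow : IsPreactivationFlow k a b u v d)
    (h : IsLazyRegime k a b R c u₀) (hT : 0 ≤ T)
    (hd : ∀ t ∈ Icc 0 T, d t ⬝ᵥ d t ≤ c * Real.exp (-(b / 2) * t)) : ‖u T - u 0‖ ≤ R := by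
  have hb := h.friction_pos
  refine (norm_sub_le_of_norm_deriv_le_exp (v := v) (β := b / 4)
    (c := 4 / (3 * b) * (√(n * c) / √m)) (by positivity) hT (by positivity)
    (fun t ht => (hflow.hasDerivWithinAt_preact t ht.1).mono Icc_subset_Ici_self)
    fun t ht => ?_).trans (Eq.trans_le ?_ h.travel_le)
  · have hnonneg : 0 ≤ 4 / (3 * b) * (√(n * c) / √m) * Real.exp (-(b / 4) * t) := by positivity
    refine (pi_norm_le_iff_of_nonneg hnonneg).2 fun r =>
      (pi_norm_le_iff_of_nonneg hnonneg).2 fun i => ?_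
    exact hflow.abs_velocity_le h ht.1 (fun τ hτ => hd τ ⟨hτ.1, hτ.2.trans ht.2⟩) r i
  · field_simp
    ring

theorem IsLazyRegime.dotProduct_gatedVelocity_sub_gates_le (h : IsLazyRegime k a b R c u₀)
    (hc : 0 ≤ c) (hE : 0 ≤ E) (hs : ∀ r i, s r i ∈ reluSubdiff (u₁ r i)) (hu : ‖u₁ - u₀‖ ≤ R)
    (hw : ∀ r i, |w r i| ≤ 4 / (3 * b) * (√(n * c) / √m) * E) :
    gatedVelocity a (s - gates u₀) w ⬝ᵥ gatedVelocity a (s - gates u₀) w ≤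
      b ^ 2 / 576 * (c * E ^ 2) := by
  have hb := h.friction_pos
  have hm : (0 : ℝ) < m := Nat.cast_pos.2 h.width_pos
  calc _ ≤ (1 / √m * (nearKinkCount R u₀ * (4 / (3 * b) * (√(n * c) / √m) * E))) ^ 2 := by
        refine (dotProduct_gatedVelocity_le h.abs_sign hw).trans ?_
        gcongr
        exact sum_abs_sub_gates_le_nearKinkCount hs hu
    _ = 16 / (9 * b ^ 2) * (c * E ^ 2) * (n * (nearKinkCount R u₀ / m) ^ 2) := by
        simp only [mul_pow, div_pow, Real.sq_sqrt hm.le,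
          Real.sq_sqrt (mul_nonneg n.cast_nonneg hc)]
        field_simp
        ring
    _ ≤ 16 / (9 * b ^ 2) * (c * E ^ 2) * (b ^ 4 / 1024) := by
        gcongr
        exact h.nearKink_le
    _ = b ^ 2 / 576 * (c * E ^ 2) := by
        field_simp
        ring

theorem IsLazyRegime.dotProduct_gatedKernel_sub_gates_le (h : IsLazyRegime k a b R c u₀)
    (hc : 0 ≤ c) (hs : ∀ r i, s r i ∈ reluSubdiff (u₁ r i)) (hu : ‖u₁ - u₀‖ ≤ R)
    (hz : z ⬝ᵥ z ≤ c * E ^ 2) :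
    (gatedKernel k (gates u₀) (s - gates u₀) *ᵥ z) ⬝ᵥ
      gatedKernel k (gates u₀) (s - gates u₀) *ᵥ z ≤ b ^ 4 / 1024 * (c * E ^ 2) := by
  calc _ ≤ n * (nearKinkCount R u₀ / m * √(c * E ^ 2)) ^ 2 := by
        refine (dotProduct_gatedKernel_mulVec_le h.abs_gram_le (abs_gates_le_one u₀)
          (abs_apply_le_sqrt hz)).trans ?_
        gcongr
        exact sum_abs_sub_gates_le_nearKinkCount hs hu
    _ = n * (nearKinkCount R u₀ / m) ^ 2 * (c * E ^ 2) := by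
        rw [mul_pow, Real.sq_sqrt (by positivity), mul_assoc]
    _ ≤ b ^ 4 / 1024 * (c * E ^ 2) := by
        gcongr
        exact h.nearKink_le

theorem IsLazyRegime.oscEnergy_gateForcing_le (h : IsLazyRegime k a b R c u₀)
    (hc : 0 ≤ c) (hE : 0 ≤ E) (hs : ∀ r i, s r i ∈ reluSubdiff (u₁ r i)) (hu : ‖u₁ - u₀‖ ≤ R)
    (hw : ∀ r i, |w r i| ≤ 4 / (3 * b) * (√(n * c) / √m) * E) (hz : z ⬝ᵥ z ≤ c * E ^ 2) :
    oscEnergy (frozenStiffness k b (gates u₀)) (gateForcing k a b (gates u₀) s w z)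
      (gatedVelocity a (s - gates u₀) w) ≤ b ^ 2 / 56 * (c * E ^ 2) := by
  have hb := h.friction_pos
  have hvel := h.dotProduct_gatedVelocity_sub_gates_le hc hE hs hu hw
  have hker := h.dotProduct_gatedKernel_sub_gates_le hc hs hu hz
  have hforcing : gateForcing k a b (gates u₀) s w z ⬝ᵥ gateForcing k a b (gates u₀) s w z ≤
      13 / 4608 * b ^ 4 * (c * E ^ 2) := by
    refine (dotProduct_self_sub_le _ _).trans ?_
    rw [smul_dotProduct, dotProduct_smul, smul_eq_mul, smul_eq_mul]
    linear_combination 2 * hker + b ^ 2 / 2 * hvel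
  calc _ ≤ (3 / 16 * b ^ 2)⁻¹ * (13 / 4608 * b ^ 4 * (c * E ^ 2)) +
        b ^ 2 / 576 * (c * E ^ 2) := by
        refine (oscEnergy_le_of_coercive h.posDef_frozenStiffness (by positivity)
          (coercive_frozenStiffness h.coercive) _ _).trans ?_
        gcongr
    _ = 29 / 1728 * (b ^ 2 * (c * E ^ 2)) := by
        field_simp
        ring
    _ ≤ b ^ 2 / 56 * (c * E ^ 2) := by
        have hnonneg : 0 ≤ b ^ 2 * (c * E ^ 2) := by positivity
        linarith

theorem IsLazyRegime.oscEnergy_frozenMomentum_zero_le (h : IsLazyRegime k a b R c u₀)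
    (s₀ : Fin m → Fin n → ℝ) (z : Fin n → ℝ) :
    oscEnergy (frozenStiffness k b (gates u₀)) (frozenMomentum a b s₀ 0 z) z ≤
      7 / 3 * (z ⬝ᵥ z) := by
  have hb := h.friction_pos
  refine (oscEnergy_le_of_coercive h.posDef_frozenStiffness
    (by positivity) (coercive_frozenStiffness h.coercive) _ _).trans_eq ?_
  have hzero : gatedVelocity a s₀ 0 = 0 := by
    ext i
    simp [gatedVelocity]
  rw [frozenMomentum, hzero, zero_add, smul_dotProduct, dotProduct_smul, smul_eq_mul, smul_eq_mul]
  field_simp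
  ring

theorem IsPreactivationFlow.residual_lt (hflow : IsPreactivationFlow k a b u v d)
    (h : IsLazyRegime k a b R c (u 0)) (hc : 0 < c) (hd0 : 7 / 2 * (d 0 ⬝ᵥ d 0) ≤ c) (hT : 0 ≤ T)
    (hd : ∀ t ∈ Icc 0 T, d t ⬝ᵥ d t ≤ c * Real.exp (-(b / 2) * t)) :
    d T ⬝ᵥ d T < c * Real.exp (-(b / 2) * T) := by
  have hb := h.friction_pos
  have henergy := oscEnergy_le_of_forcing h.posDef_frozenStiffness (ε := b ^ 2 / 56 * c)
    (q := fun t => frozenMomentum a b (gates (u 0)) (v t) (d t)) (d := d) hb hT (by positivity)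
    (fun i => (absolutelyContinuousOnInterval_gatedVelocity a _
      (fun r i => hflow.absolutelyContinuous_velocity r i T hT) i).fun_add
      ((hflow.absolutelyContinuous_residual i T hT).const_mul (b / 2)))
    (fun i => hflow.absolutelyContinuous_residual i T hT) <| by
      filter_upwards [hflow.ae_hasDerivAt] with t ht htT
      obtain ⟨s, hs, hv, hdt⟩ := ht htT.1
      have hd' : ∀ τ ∈ Icc 0 t, d τ ⬝ᵥ d τ ≤ c * Real.exp (-(b / 2) * τ) := fun τ hτ =>
        hd τ ⟨hτ.1, hτ.2.trans htT.2⟩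
      have hexp : Real.exp (-(b / 2) * t) = Real.exp (-(b / 4) * t) ^ 2 := by
        rw [← Real.exp_nat_mul]
        ring_nf
      refine ⟨_, _, hasDerivAt_frozenMomentum h.abs_sign hv hdt,
        hdt.congr_deriv (gatedVelocity_eq_frozenMomentum a b _ s _ _), ?_⟩
      rw [mul_assoc, hexp]
      exact h.oscEnergy_gateForcing_le hc.le (Real.exp_pos _).le hs
        (hflow.norm_preact_sub_le h htT.1 hd') (hflow.abs_velocity_le h htT.1 hd')
        (hexp ▸ hd t htT)
  refine ((dotProduct_self_le_oscEnergy h.posDef_frozenStiffness _ _).trans henergy).trans_lt ?_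
  have hzero := h.oscEnergy_frozenMomentum_zero_le (gates (u 0)) (d 0)
  rw [← hflow.velocity_zero] at hzero
  have hforcing : 16 / b ^ 2 * (b ^ 2 / 56 * c) = 2 / 7 * c := by
    field_simp
    ring
  gcongr
  linarith

theorem IsPreactivationFlow.residual_le (hflow : IsPreactivationFlow k a b u v d)
    (h : IsLazyRegime k a b R c (u 0)) (hd0 : 7 / 2 * (d 0 ⬝ᵥ d 0) < c) (hT : 0 ≤ T) :
    d T ⬝ᵥ d T ≤ 7 / 2 * (d 0 ⬝ᵥ d 0) * Real.exp (-(b / 2) * T) := by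
  have hsq : 0 ≤ d 0 ⬝ᵥ d 0 := dotProduct_self_nonneg _
  have hcont : ContinuousOn d (Icc 0 T) := continuousOn_pi.2 fun i => by
    simpa only [uIcc_of_le hT] using (hflow.absolutelyContinuous_residual i T hT).continuousOn
  have hsq_cont : ContinuousOn (fun t => d t ⬝ᵥ d t) (Icc 0 T) :=
    (by fun_prop : Continuous fun z : Fin n → ℝ => z ⬝ᵥ z).comp_continuousOn hcont
  have hexp : ∀ t C, d t ⬝ᵥ d t * Real.exp (b / 2 * t) ≤ C ↔
      d t ⬝ᵥ d t ≤ C * Real.exp (-(b / 2) * t) := fun t C => by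
    rw [neg_mul, Real.exp_neg, ← div_eq_mul_inv, le_div_iff₀ (Real.exp_pos _)]
  rw [← hexp]
  refine le_of_forall_gt_imp_ge_of_dense fun c' hc' => ?_
  have hmin : 7 / 2 * (d 0 ⬝ᵥ d 0) < min c' c := lt_min hc' hd0
  have hlt : d T ⬝ᵥ d T * Real.exp (b / 2 * T) < min c' c := by
    refine lt_of_forall_le_imp_lt (φ := fun t => d t ⬝ᵥ d t * Real.exp (b / 2 * t)) hT
      (hsq_cont.mul (by fun_prop)) ?_ fun t ht hle => ?_
    · simp only [mul_zero, Real.exp_zero, mul_one]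
      linarith
    · have := hflow.residual_lt (h.mono (min_le_right c' c)) (by linarith) hmin.le ht.1
        fun τ hτ => (hexp τ _).1 (hle τ hτ)
      rwa [neg_mul, Real.exp_neg, ← div_eq_mul_inv, lt_div_iff₀ (Real.exp_pos _)] at this
  exact hlt.le.trans (min_le_left _ _)

theorem ntk_eq_gatedKernel (x : Fin n → EuclideanSpace ℝ (Fin p)) (ha : ∀ r, |a r| = 1)
    (W : Weights m p) :
    ntk x a W = gatedKernel (Matrix.gram ℝ x) (gates (preact x W)) (gates (preact x W)) := by
  ext i j
  rw [ntk, gatedKernel, Matrix.of_apply, Matrix.of_apply, Finset.mul_sum, Finset.mul_sum]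
  refine Finset.sum_congr rfl fun r _ => ?_
  have hsign : a r * a r = 1 := by rw [← abs_mul_abs_self, ha r, one_mul]
  rw [netGrad, netGrad, real_inner_smul_left, real_inner_smul_right, Matrix.gram_apply,
    ← one_div_sqrt_mul_self m, gates, gates, preact_apply, preact_apply]
  linear_combination (1 / √(m : ℝ) * (1 / √(m : ℝ)) * reluDeriv (inner ℝ (W r) (x i)) *
    reluDeriv (inner ℝ (W r) (x j)) * inner ℝ (x i) (x j)) * hsign

theorem loss_eq_dotProduct (x : Fin n → EuclideanSpace ℝ (Fin p)) (y : Fin n → ℝ)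
    (a : Fin m → ℝ) (W : Weights m p) :
    loss x y a W = 1 / 2 * (err x y a W ⬝ᵥ err x y a W) := by
  simp only [loss, dotProduct, sq]

theorem IsHBFlow.loss_le {x : Fin n → EuclideanSpace ℝ (Fin p)} {y : Fin n → ℝ} {lam t : ℝ}
    {W₀ : Weights m p} {W : ℝ → Weights m p} (hflow : IsHBFlow x y a √(2 * lam) W₀ W)
    (h : IsLazyRegime (Matrix.gram ℝ x) a √(2 * lam) R c (preact x W₀))
    (hc : 7 / 2 * (err x y a W₀ ⬝ᵥ err x y a W₀) < c) (ht : 0 ≤ t) :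
    loss x y a (W t) ≤ 4 / lam * Real.exp (-√(lam / 2) * t) * pseudoLoss x y a W₀ := by
  have hlam : 0 < lam := by linarith [Real.sqrt_pos.1 h.friction_pos]
  obtain ⟨v, hv⟩ := hflow.exists_isPreactivationFlow
  obtain rfl : W 0 = W₀ := hflow.1
  have hres := hv.residual_le h hc ht
  have hcoer := h.coercive (err x y a (W 0))
  rw [← ntk_eq_gatedKernel x h.abs_sign, Real.sq_sqrt (by positivity)] at hcoer
  rw [show √(2 * lam) / 2 = √(lam / 2) by rw [← two_mul_sqrt_half]; ring] at hres
  rw [loss_eq_dotProduct, pseudoLoss]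
  calc 1 / 2 * (err x y a (W t) ⬝ᵥ err x y a (W t))
      ≤ 1 / 2 * (7 / 2 * (err x y a (W 0) ⬝ᵥ err x y a (W 0)) * Real.exp (-√(lam / 2) * t)) := by
        gcongr
    _ = 2 / lam * (7 / 16 * (2 * lam) * (err x y a (W 0) ⬝ᵥ err x y a (W 0))) *
        Real.exp (-√(lam / 2) * t) := by
        field_simp
        ring
    _ ≤ 2 / lam * (err x y a (W 0) ⬝ᵥ ntk x a (W 0) *ᵥ err x y a (W 0)) *
        Real.exp (-√(lam / 2) * t) := by gcongr
    _ = _ := by ring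

end LinearConvergence

section LimitKernel

open scoped Matrix

variable {x : Fin n → EuclideanSpace ℝ (Fin p)}

/-- The integrand of the limiting kernel `H^∞`, as a function of the weights of one neuron. -/
def kernelIntegrand (x : Fin n → EuclideanSpace ℝ (Fin p)) (i j : Fin n)
    (w : EuclideanSpace ℝ (Fin p)) : ℝ :=
  inner ℝ (x i) (x j) * (reluDeriv (inner ℝ w (x i)) * reluDeriv (inner ℝ w (x j)))

theorem limitNTK_apply (x : Fin n → EuclideanSpace ℝ (Fin p)) (i j : Fin n) :
    limitNTK x i j =
      ∫ w, kernelIntegrand x i j w ∂(stdGaussian (EuclideanSpace ℝ (Fin p))) :=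
  rfl

theorem gatedKernel_gates_apply (x : Fin n → EuclideanSpace ℝ (Fin p)) (W : Weights m p)
    (i j : Fin n) : gatedKernel (Matrix.gram ℝ x) (gates (preact x W)) (gates (preact x W)) i j =
      ∑ r, 1 / (m : ℝ) * kernelIntegrand x i j (W r) := by
  simp only [gatedKernel, Matrix.of_apply, Matrix.gram_apply, kernelIntegrand, gates, preact_apply,
    Finset.mul_sum]
  exact Finset.sum_congr rfl fun r _ => by ring

theorem measurable_kernelIntegrand (x : Fin n → EuclideanSpace ℝ (Fin p)) (i j : Fin n) :
    Measurable (kernelIntegrand x i j) := by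
  have hrelu : Measurable reluDeriv :=
    Measurable.ite measurableSet_Ici measurable_const measurable_const
  unfold kernelIntegrand
  fun_prop

theorem abs_gram_le_one (hx : ∀ i, ‖x i‖ = 1) (i j : Fin n) : |Matrix.gram ℝ x i j| ≤ 1 := by
  simpa [hx, Matrix.gram_apply] using abs_real_inner_le_norm (x i) (x j)

theorem abs_kernelIntegrand_le_one (hx : ∀ i, ‖x i‖ = 1) (i j : Fin n)
    (w : EuclideanSpace ℝ (Fin p)) : |kernelIntegrand x i j w| ≤ 1 := by
  have hrelu := fun z => abs_le_one_of_mem_reluSubdiff (reluDeriv_mem_reluSubdiff z)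
  rw [kernelIntegrand, abs_mul, abs_mul]
  exact mul_le_one₀ (abs_gram_le_one hx i j) (by positivity)
    (mul_le_one₀ (hrelu _) (abs_nonneg _) (hrelu _))

theorem isHermitian_limitNTK (x : Fin n → EuclideanSpace ℝ (Fin p)) :
    (limitNTK x).IsHermitian := by
  ext i j
  simp only [Matrix.conjTranspose_apply, star_trivial, limitNTK_apply, kernelIntegrand,
    real_inner_comm (x i) (x j), mul_comm (reluDeriv (inner ℝ _ (x i)))]

theorem card_pos_of_lam0_pos (h : 0 < lam0 x) : 0 < n := by
  refine Nat.pos_of_ne_zero ?_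
  rintro rfl
  simp [lam0, spectrum.of_subsingleton] at h

theorem lam0_le_one (hx : ∀ i, ‖x i‖ = 1) (hn : 0 < n) : lam0 x ≤ 1 := by
  let i : Fin n := ⟨0, hn⟩
  have hdiag := sInf_spectrum_mul_dotProduct_le (isHermitian_limitNTK x) (Pi.single i 1)
  simp only [dotProduct_single, Pi.single_eq_same, mul_one, Matrix.mulVec_single_one,
    single_dotProduct, one_mul] at hdiag
  refine hdiag.trans ((le_abs_self _).trans ?_)
  simpa [limitNTK_apply] using norm_integral_le_of_norm_le_const
    (f := kernelIntegrand x i i) (C := 1) (μ := stdGaussian (EuclideanSpace ℝ (Fin p)))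
    (Eventually.of_forall (abs_kernelIntegrand_le_one hx i i))

end LimitKernel

section Moments

variable {Ω ι : Type*} [MeasurableSpace Ω] {μ : Measure Ω}

theorem lintegral_ofReal_sum_le [Fintype ι] {f : ι → Ω → ℝ} {c : ℝ}
    (hf : ∀ i, Measurable (f i)) (hf₀ : ∀ i ω, 0 ≤ f i ω)
    (h : ∀ i, ∫⁻ ω, ENNReal.ofReal (f i ω) ∂μ ≤ ENNReal.ofReal c) :
    ∫⁻ ω, ENNReal.ofReal (∑ i, f i ω) ∂μ ≤ ENNReal.ofReal (Fintype.card ι * c) := by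
  simp_rw [ENNReal.ofReal_sum_of_nonneg fun i _ => hf₀ i _]
  rw [lintegral_finsetSum _ fun i _ => (hf i).ennreal_ofReal,
    ENNReal.ofReal_mul (Nat.cast_nonneg _), ENNReal.ofReal_natCast, ← nsmul_eq_mul]
  exact Finset.sum_le_card_nsmul _ _ _ fun i _ => h i

theorem lintegral_sq_sum_sub_integral_pi [Fintype ι] [IsProbabilityMeasure μ] {X : ι → Ω → ℝ}
    (hX : ∀ r, MemLp (X r) 2 μ) :
    ∫⁻ ω : ι → Ω, ENNReal.ofReal ((∑ r, X r (ω r) - ∑ r, ∫ z, X r z ∂μ) ^ 2)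
        ∂(Measure.pi fun _ => μ) = ENNReal.ofReal (∑ r, Var[X r; μ]) := by
  have hcoord : ∀ r, MemLp (fun ω : ι → Ω => X r (ω r)) 2 (Measure.pi fun _ => μ) := fun r =>
    (hX r).comp_measurePreserving (measurePreserving_eval (fun _ => μ) r)
  have hmean : ∫ ω, (∑ r, fun ω : ι → Ω => X r (ω r)) ω ∂(Measure.pi fun _ => μ) =
      ∑ r, ∫ z, X r z ∂μ := by
    simp only [Finset.sum_apply]
    rw [integral_finsetSum _ fun r _ => (hcoord r).integrable one_le_two]
    exact Finset.sum_congr rfl fun r _ =>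
      integral_comp_eval (μ := fun _ => μ) (hX r).aestronglyMeasurable
  rw [← variance_sum_pi hX, ofReal_variance (memLp_finsetSum' _ fun r _ => hcoord r),
    evariance_eq_lintegral_ofReal, hmean]
  simp only [Finset.sum_apply]

theorem variance_le_one_of_ae_abs_le_one [IsProbabilityMeasure μ] {X : Ω → ℝ}
    (hX : AEMeasurable X μ) (h : ∀ᵐ ω ∂μ, |X ω| ≤ 1) : Var[X; μ] ≤ 1 := by
  have hvar := variance_le_sq_of_bounded (h.mono fun ω hω => abs_le.1 hω) hX
  norm_num at hvar
  exact hvar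

theorem memLp_two_of_ae_abs_le_one [IsProbabilityMeasure μ] {X : Ω → ℝ}
    (hX : AEMeasurable X μ) (h : ∀ᵐ ω ∂μ, |X ω| ≤ 1) : MemLp X 2 μ :=
  memLp_of_bounded (h.mono fun _ hω => abs_le.1 hω) hX.aestronglyMeasurable 2

theorem ofReal_one_sub_le_measure_setOf_lt [IsProbabilityMeasure μ] {f : Ω → ℝ} {c ε δ : ℝ}
    (hf : Measurable f) (hε : 0 < ε) (hδ : 0 ≤ δ)
    (h : ∫⁻ ω, ENNReal.ofReal (f ω) ∂μ ≤ ENNReal.ofReal c) (hc : c ≤ ε * δ) :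
    ENNReal.ofReal (1 - δ) ≤ μ {ω | f ω < ε} := by
  have hmarkov : μ {ω | ε ≤ f ω} ≤ ENNReal.ofReal δ := by
    have hle := mul_meas_ge_le_lintegral (μ := μ) hf.ennreal_ofReal (ENNReal.ofReal ε)
    simp_rw [ENNReal.ofReal_le_ofReal_iff' (p := ε), not_le.2 hε, or_false] at hle
    have hchain := hle.trans (h.trans (ENNReal.ofReal_le_ofReal hc))
    rwa [ENNReal.ofReal_mul hε.le,
      ENNReal.mul_le_mul_iff_right (ENNReal.ofReal_pos.2 hε).ne' ENNReal.ofReal_ne_top] at hchain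
  have hcompl : {ω | f ω < ε} = {ω | ε ≤ f ω}ᶜ := by
    ext ω
    simp
  rw [hcompl, prob_compl_eq_one_sub (measurableSet_le measurable_const hf),
    ENNReal.ofReal_sub _ hδ, ENNReal.ofReal_one]
  exact tsub_le_tsub_left hmarkov 1

theorem ofReal_one_sub_add_le_measure_inter [IsProbabilityMeasure μ] {S T : Set Ω} {ε δ : ℝ}
    (hS : ENNReal.ofReal (1 - ε) ≤ μ S) (hT : ENNReal.ofReal (1 - δ) ≤ μ T)
    (hT_meas : MeasurableSet T) : ENNReal.ofReal (1 - (ε + δ)) ≤ μ (S ∩ T) := by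
  rw [ENNReal.ofReal_le_iff_le_toReal (measure_ne_top _ _), ← measureReal_def] at *
  linarith [measureReal_union_add_inter (μ := μ) (s := S) hT_meas,
    measureReal_le_one (μ := μ) (s := S ∪ T)]

end Moments

section Gaussian

variable {z : EuclideanSpace ℝ (Fin p)}

theorem map_inner_stdGaussian (hz : ‖z‖ = 1) :
    (stdGaussian (EuclideanSpace ℝ (Fin p))).map (fun w => inner ℝ w z) = gaussianReal 0 1 := by
  have hmap := IsGaussian.map_eq_gaussianReal (μ := stdGaussian (EuclideanSpace ℝ (Fin p)))
    (innerSL ℝ z)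
  rw [variance_dual_stdGaussian, integral_strongDual_stdGaussian, innerSL_apply_norm, hz, one_pow,
    Real.toNNReal_one] at hmap
  have hcomm : (fun w => inner ℝ w z) = ⇑(innerSL ℝ z) := funext fun w => real_inner_comm z w
  rw [hcomm, hmap]

theorem lintegral_sq_gaussianReal :
    ∫⁻ z : ℝ, ENNReal.ofReal (z ^ 2) ∂(gaussianReal 0 1) = 1 := by
  have hvar := variance_id_gaussianReal (μ := 0) (v := 1)
  rw [variance_eq_integral (by fun_prop)] at hvar
  simp only [id, integral_id_gaussianReal, sub_zero, NNReal.coe_one] at hvar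
  rw [← ofReal_integral_eq_lintegral_ofReal (f := fun z => z ^ 2)
    (memLp_id_gaussianReal 2).integrable_sq (Eventually.of_forall sq_nonneg), hvar,
    ENNReal.ofReal_one]

theorem lintegral_inner_sq_stdGaussian (hz : ‖z‖ = 1) :
    ∫⁻ w, ENNReal.ofReal (inner ℝ w z ^ 2) ∂(stdGaussian (EuclideanSpace ℝ (Fin p))) = 1 := by
  rw [← lintegral_sq_gaussianReal, ← map_inner_stdGaussian hz,
    lintegral_map (by fun_prop) (by fun_prop)]

theorem gaussianPDFReal_zero_one_le (z : ℝ) : gaussianPDFReal 0 1 z ≤ 1 / 2 := by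
  have hexp : Real.exp (-(z - 0) ^ 2 / (2 * ((1 : NNReal) : ℝ))) ≤ 1 :=
    Real.exp_le_one_iff.2 (div_nonpos_of_nonpos_of_nonneg (by simp [sq_nonneg]) (by simp))
  have hnormalizer : (√(2 * Real.pi * ((1 : NNReal) : ℝ)))⁻¹ ≤ 1 / 2 := by
    rw [one_div, NNReal.coe_one]
    refine inv_anti₀ two_pos (Real.le_sqrt_of_sq_le ?_)
    linarith [Real.pi_gt_three]
  rw [gaussianPDFReal]
  exact (mul_le_of_le_one_right (by positivity) hexp).trans hnormalizer

theorem stdGaussian_setOf_abs_inner_le (hz : ‖z‖ = 1) (R : ℝ) :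
    stdGaussian (EuclideanSpace ℝ (Fin p)) {w | |inner ℝ w z| ≤ R} ≤ ENNReal.ofReal R := by
  have hpreimage : {w : EuclideanSpace ℝ (Fin p) | |inner ℝ w z| ≤ R} =
      (fun w => inner ℝ w z) ⁻¹' Icc (-R) R := by
    ext w
    simp [abs_le]
  rw [hpreimage, ← Measure.map_apply (by fun_prop) measurableSet_Icc, map_inner_stdGaussian hz,
    gaussianReal_apply _ one_ne_zero]
  calc ∫⁻ z in Icc (-R) R, gaussianPDF 0 1 z
      ≤ ∫⁻ _ in Icc (-R) R, ENNReal.ofReal (1 / 2) :=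
        lintegral_mono fun z => ENNReal.ofReal_le_ofReal (gaussianPDFReal_zero_one_le z)
    _ = ENNReal.ofReal R := by
        rw [setLIntegral_const, Real.volume_Icc, ← ENNReal.ofReal_mul (by norm_num)]
        ring_nf

end Gaussian

section Initialization

/-- The uniform law on `{-1, 1}`, in the form in which it occurs in `initLaw`; an abbreviation, so
that lemmas about it apply to `initLaw` by unification. -/
abbrev signLaw : Measure ℝ :=
  (2⁻¹ : ENNReal) • Measure.dirac (1 : ℝ) + (2⁻¹ : ENNReal) • Measure.dirac (-1 : ℝ)

instance isProbabilityMeasure_signLaw : IsProbabilityMeasure signLaw :=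
  ⟨by simp [ENNReal.inv_two_add_inv_two]⟩

instance isProbabilityMeasure_initLaw : IsProbabilityMeasure (initLaw m p) := by
  unfold initLaw
  infer_instance

theorem integral_id_signLaw : ∫ z, z ∂signLaw = 0 := by
  rw [integral_add_measure ((integrable_dirac (by simp)).smul_measure (by simp))
    ((integrable_dirac (by simp)).smul_measure (by simp))]
  simp

theorem ae_abs_eq_one_signLaw : ∀ᵐ z ∂signLaw, |z| = 1 := by
  rw [ae_add_measure_iff]
  constructor <;> exact Measure.ae_smul_measure (by simp [ae_dirac_eq]) _

theorem lintegral_sq_sum_mul_signLaw_le {ι : Type*} [Fintype ι] (c : ι → ℝ) :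
    ∫⁻ a : ι → ℝ, ENNReal.ofReal ((∑ r, c r * a r) ^ 2) ∂(Measure.pi fun _ => signLaw) ≤
      ENNReal.ofReal (∑ r, c r ^ 2) := by
  have habs : ∀ᵐ z ∂signLaw, |z| ≤ 1 := ae_abs_eq_one_signLaw.mono fun _ hz => hz.le
  have hsecond := lintegral_sq_sum_sub_integral_pi (X := fun r z => c r * z)
    fun r => (memLp_two_of_ae_abs_le_one aemeasurable_id habs).const_mul (c r)
  have hmean : ∀ r, ∫ z, c r * z ∂signLaw = 0 := fun r => by
    rw [integral_const_mul, integral_id_signLaw, mul_zero]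
  simp only [hmean, Finset.sum_const_zero, sub_zero] at hsecond
  rw [hsecond]
  refine ENNReal.ofReal_le_ofReal (Finset.sum_le_sum fun r _ => ?_)
  rw [variance_const_mul]
  exact mul_le_of_le_one_right (sq_nonneg _) (variance_le_one_of_ae_abs_le_one aemeasurable_id habs)

theorem measurePreserving_weights :
    MeasurePreserving Prod.fst (initLaw m p)
      (Measure.pi fun _ : Fin m => stdGaussian (EuclideanSpace ℝ (Fin p))) :=
  measurePreserving_fst

theorem measurePreserving_neuron (r : Fin m) :
    MeasurePreserving (fun ω => ω.1 r) (initLaw m p) (stdGaussian (EuclideanSpace ℝ (Fin p))) :=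
  (measurePreserving_eval _ r).comp measurePreserving_weights

theorem ae_abs_sign_eq_one_initLaw : ∀ᵐ ω ∂(initLaw m p), ∀ r, |ω.2 r| = 1 := by
  have hsigns : ∀ᵐ a ∂(Measure.pi fun _ : Fin m => signLaw), ∀ r, |a r| = 1 :=
    ae_all_iff.2 fun r =>
      (measurePreserving_eval (fun _ => signLaw) r).quasiMeasurePreserving.ae ae_abs_eq_one_signLaw
  exact measurePreserving_snd.quasiMeasurePreserving.ae hsigns

theorem measurable_net (z : EuclideanSpace ℝ (Fin p)) :
    Measurable fun ω : Weights m p × (Fin m → ℝ) => net ω.2 ω.1 z := by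
  have hrelu := continuous_relu
  refine Continuous.measurable ?_
  unfold net
  fun_prop

theorem lintegral_sq_net_signs_le (W : Weights m p) (z : EuclideanSpace ℝ (Fin p)) :
    ∫⁻ a, ENNReal.ofReal (net a W z ^ 2) ∂(Measure.pi fun _ : Fin m => signLaw) ≤
      ENNReal.ofReal (∑ r, 1 / (m : ℝ) * inner ℝ (W r) z ^ 2) := by
  have hnet : ∀ a, net a W z = ∑ r, 1 / √(m : ℝ) * relu (inner ℝ (W r) z) * a r := fun a => by
    rw [net, Finset.mul_sum]
    exact Finset.sum_congr rfl fun r _ => by ring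
  simp_rw [hnet]
  refine (lintegral_sq_sum_mul_signLaw_le _).trans
    (ENNReal.ofReal_le_ofReal (Finset.sum_le_sum fun r _ => ?_))
  have hrelu : relu (inner ℝ (W r) z) ^ 2 ≤ inner ℝ (W r) z ^ 2 :=
    sq_le_sq.2 (abs_max_le_max_abs_abs.trans (by simp))
  rw [mul_pow, sq (1 / √(m : ℝ)), one_div_sqrt_mul_self]
  exact mul_le_mul_of_nonneg_left hrelu (by positivity)

theorem lintegral_sq_net_initLaw_le {z : EuclideanSpace ℝ (Fin p)} (hz : ‖z‖ = 1) :
    ∫⁻ ω, ENNReal.ofReal (net ω.2 ω.1 z ^ 2) ∂(initLaw m p) ≤ 1 := by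
  have hneuron : ∀ r : Fin m, ∫⁻ W : Weights m p, ENNReal.ofReal (1 / (m : ℝ) *
      inner ℝ (W r) z ^ 2) ∂(Measure.pi fun _ => stdGaussian (EuclideanSpace ℝ (Fin p))) ≤
      ENNReal.ofReal (1 / m) := fun r => by
    have hmoment := (measurePreserving_eval (fun _ : Fin m =>
      stdGaussian (EuclideanSpace ℝ (Fin p))) r).lintegral_comp
        (f := fun w => ENNReal.ofReal (inner ℝ w z ^ 2)) (by fun_prop)
    simp_rw [ENNReal.ofReal_mul (one_div_nonneg.2 (Nat.cast_nonneg m))]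
    rw [lintegral_const_mul _ (by fun_prop)]
    exact (congrArg _ (hmoment.trans (lintegral_inner_sq_stdGaussian hz))).trans_le
      (mul_one _).le
  rw [initLaw, lintegral_prod _ ((measurable_net z).pow_const 2).ennreal_ofReal.aemeasurable]
  refine (lintegral_mono fun W => lintegral_sq_net_signs_le W z).trans ?_
  refine (lintegral_ofReal_sum_le (fun r => by fun_prop) (fun r W => by positivity)
    hneuron).trans ?_
  rw [Fintype.card_fin, ← ENNReal.ofReal_one, mul_one_div]
  exact ENNReal.ofReal_le_ofReal (div_self_le_one _)

variable {x : Fin n → EuclideanSpace ℝ (Fin p)} {y : Fin n → ℝ}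

theorem measurable_dotProduct_err_initLaw (x : Fin n → EuclideanSpace ℝ (Fin p)) (y : Fin n → ℝ) :
    Measurable fun ω : Weights m p × (Fin m → ℝ) => err x y ω.2 ω.1 ⬝ᵥ err x y ω.2 ω.1 :=
  Finset.measurable_sum _ fun i _ => ((measurable_net (x i)).sub_const (y i)).mul
    ((measurable_net (x i)).sub_const (y i))

theorem lintegral_sq_err_le {C : ℝ} {i : Fin n} (hx : ‖x i‖ = 1) (hy : |y i| ≤ C) :
    ∫⁻ ω, ENNReal.ofReal (err x y ω.2 ω.1 i ^ 2) ∂(initLaw m p) ≤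
      ENNReal.ofReal (2 + 2 * C ^ 2) := by
  have hyC : y i ^ 2 ≤ C ^ 2 := sq_le_sq' (abs_le.1 hy).1 (abs_le.1 hy).2
  calc ∫⁻ ω, ENNReal.ofReal (err x y ω.2 ω.1 i ^ 2) ∂(initLaw m p)
      ≤ ∫⁻ ω, (ENNReal.ofReal 2 * ENNReal.ofReal (net ω.2 ω.1 (x i) ^ 2)
          + ENNReal.ofReal (2 * C ^ 2)) ∂(initLaw m p) := by
        refine lintegral_mono fun ω => ?_
        rw [← ENNReal.ofReal_mul (by norm_num), ← ENNReal.ofReal_add (by positivity)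
          (by positivity)]
        refine ENNReal.ofReal_le_ofReal ?_
        rw [err]
        linarith [sq_nonneg (net ω.2 ω.1 (x i) + y i)]
    _ = ENNReal.ofReal 2 * ∫⁻ ω, ENNReal.ofReal (net ω.2 ω.1 (x i) ^ 2) ∂(initLaw m p)
          + ENNReal.ofReal (2 * C ^ 2) := by
        rw [lintegral_add_right _ measurable_const, lintegral_const, measure_univ, mul_one,
          lintegral_const_mul _ ((measurable_net (x i)).pow_const 2).ennreal_ofReal]
    _ ≤ ENNReal.ofReal 2 * 1 + ENNReal.ofReal (2 * C ^ 2) := by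
        gcongr
        exact lintegral_sq_net_initLaw_le hx
    _ = ENNReal.ofReal (2 + 2 * C ^ 2) := by
        rw [mul_one, ENNReal.ofReal_add (by norm_num) (by positivity)]

theorem lintegral_dotProduct_err_le {C : ℝ} (hx : ∀ i, ‖x i‖ = 1) (hy : ∀ i, |y i| ≤ C) :
    ∫⁻ ω, ENNReal.ofReal (err x y ω.2 ω.1 ⬝ᵥ err x y ω.2 ω.1) ∂(initLaw m p) ≤
      ENNReal.ofReal (n * (2 + 2 * C ^ 2)) := by
  simp only [dotProduct, ← sq]
  have hmeas : ∀ i, Measurable fun ω : Weights m p × (Fin m → ℝ) => err x y ω.2 ω.1 i ^ 2 :=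
    fun i => ((measurable_net (x i)).sub_const (y i)).pow_const 2
  simpa only [Fintype.card_fin] using lintegral_ofReal_sum_le hmeas (fun i ω => sq_nonneg _)
    fun i => lintegral_sq_err_le (hx i) (hy i)

theorem measurableSet_abs_inner_le (z : EuclideanSpace ℝ (Fin p)) (R : ℝ) :
    MeasurableSet {w : EuclideanSpace ℝ (Fin p) | |inner ℝ w z| ≤ R} :=
  measurableSet_le (by fun_prop) measurable_const

theorem measurable_nearKink (x : Fin n → EuclideanSpace ℝ (Fin p)) (R : ℝ) (r : Fin m) (i : Fin n) :
    Measurable fun ω : Weights m p × (Fin m → ℝ) =>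
      if |preact x ω.1 r i| ≤ R then (1 : ℝ) else 0 := by
  refine Measurable.ite ?_ measurable_const measurable_const
  have hneuron : Measurable fun ω : Weights m p × (Fin m → ℝ) => ω.1 r :=
    (measurable_pi_apply r).comp measurable_fst
  simp only [preact_apply]
  exact (measurableSet_abs_inner_le (x i) R).preimage hneuron

theorem measurable_nearKinkCount (x : Fin n → EuclideanSpace ℝ (Fin p)) (R : ℝ) :
    Measurable fun ω : Weights m p × (Fin m → ℝ) => nearKinkCount R (preact x ω.1) :=
  Finset.measurable_sum _ fun i _ => Finset.measurable_sum _ fun r _ => measurable_nearKink x R r i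

theorem lintegral_nearKinkCount_le (hx : ∀ i, ‖x i‖ = 1) (R : ℝ) :
    ∫⁻ ω, ENNReal.ofReal (nearKinkCount R (preact x ω.1)) ∂(initLaw m p) ≤
      ENNReal.ofReal (n * (m * R)) := by
  have hneuron : ∀ i (r : Fin m), ∫⁻ ω : Weights m p × (Fin m → ℝ),
      ENNReal.ofReal (if |preact x ω.1 r i| ≤ R then (1 : ℝ) else 0) ∂(initLaw m p) ≤
      ENNReal.ofReal R := fun i r => by
    refine le_trans (le_of_eq ?_) (stdGaussian_setOf_abs_inner_le (hx i) R)
    rw [← (measurePreserving_neuron r).measure_preimage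
      (measurableSet_abs_inner_le (x i) R).nullMeasurableSet, ← lintegral_indicator_one
      ((measurableSet_abs_inner_le (x i) R).preimage (measurePreserving_neuron r).measurable)]
    refine lintegral_congr fun ω => ?_
    by_cases h : |inner ℝ (ω.1 r) (x i)| ≤ R <;> simp [h, preact_apply, indicator]
  have hnonneg : ∀ i r (ω : Weights m p × (Fin m → ℝ)),
      (0 : ℝ) ≤ if |preact x ω.1 r i| ≤ R then 1 else 0 := fun i r ω => by
    split_ifs <;> norm_num
  have hpoint := fun i => lintegral_ofReal_sum_le (measurable_nearKink (m := m) x R · i)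
    (hnonneg i) (hneuron i)
  simpa only [Fintype.card_fin, nearKinkCount] using lintegral_ofReal_sum_le
    (fun i => Finset.measurable_sum _ fun r _ => measurable_nearKink (m := m) x R r i)
    (fun i ω => Finset.sum_nonneg fun r _ => hnonneg i r ω) hpoint

/-- The squared Frobenius distance between the kernel `H` at the weights `W`, written as a gated
kernel, and its infinite-width limit `H^∞`. -/
def kernelDeviation (x : Fin n → EuclideanSpace ℝ (Fin p)) (W : Weights m p) : ℝ :=
  ∑ i, ∑ j, (gatedKernel (Matrix.gram ℝ x) (gates (preact x W)) (gates (preact x W)) i j -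
    limitNTK x i j) ^ 2

theorem measurable_gatedKernel_gates (x : Fin n → EuclideanSpace ℝ (Fin p)) (i j : Fin n) :
    Measurable fun W : Weights m p =>
      gatedKernel (Matrix.gram ℝ x) (gates (preact x W)) (gates (preact x W)) i j := by
  simp only [gatedKernel_gates_apply]
  exact Finset.measurable_sum _ fun r _ =>
    ((measurable_kernelIntegrand x i j).comp (measurable_pi_apply r)).const_mul _

theorem measurable_kernelDeviation (x : Fin n → EuclideanSpace ℝ (Fin p)) :
    Measurable fun W : Weights m p => kernelDeviation x W :=
  Finset.measurable_sum _ fun i _ => Finset.measurable_sum _ fun j _ =>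
    ((measurable_gatedKernel_gates x i j).sub_const _).pow_const 2

theorem lintegral_sq_gatedKernel_sub_limitNTK_le (hx : ∀ i, ‖x i‖ = 1) (hm : 0 < m) (i j : Fin n) :
    ∫⁻ W : Weights m p, ENNReal.ofReal
        ((gatedKernel (Matrix.gram ℝ x) (gates (preact x W)) (gates (preact x W)) i j -
          limitNTK x i j) ^ 2) ∂(Measure.pi fun _ => stdGaussian (EuclideanSpace ℝ (Fin p))) ≤
      ENNReal.ofReal (1 / m) := by
  have hm₀ : (m : ℝ) ≠ 0 := by positivity
  have habs := Eventually.of_forall (f := ae (stdGaussian (EuclideanSpace ℝ (Fin p))))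
    (abs_kernelIntegrand_le_one hx i j)
  have hmeas := (measurable_kernelIntegrand x i j).aemeasurable
    (μ := stdGaussian (EuclideanSpace ℝ (Fin p)))
  have hsecond := lintegral_sq_sum_sub_integral_pi
    (X := fun (_ : Fin m) w => 1 / (m : ℝ) * kernelIntegrand x i j w)
    fun _ => (memLp_two_of_ae_abs_le_one hmeas habs).const_mul _
  simp only [integral_const_mul, ← limitNTK_apply, variance_const_mul, Finset.sum_const,
    Finset.card_univ, Fintype.card_fin, nsmul_eq_mul, ← mul_assoc, mul_one_div_cancel hm₀,
    one_mul] at hsecond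
  simp only [gatedKernel_gates_apply]
  rw [hsecond]
  refine ENNReal.ofReal_le_ofReal ((mul_le_of_le_one_right (by positivity)
    (variance_le_one_of_ae_abs_le_one hmeas habs)).trans_eq ?_)
  field_simp

theorem lintegral_kernelDeviation_le (hx : ∀ i, ‖x i‖ = 1) (hm : 0 < m) :
    ∫⁻ ω, ENNReal.ofReal (kernelDeviation x ω.1) ∂(initLaw m p) ≤
      ENNReal.ofReal (n * (n * (1 / m))) := by
  rw [measurePreserving_weights.lintegral_comp (measurable_kernelDeviation x).ennreal_ofReal]
  have hmeas : ∀ i j, Measurable fun W : Weights m p =>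
      (gatedKernel (Matrix.gram ℝ x) (gates (preact x W)) (gates (preact x W)) i j -
        limitNTK x i j) ^ 2 := fun i j =>
    ((measurable_gatedKernel_gates x i j).sub_const _).pow_const 2
  have hrow := fun i => lintegral_ofReal_sum_le (hmeas i) (fun j W => sq_nonneg _)
    (lintegral_sq_gatedKernel_sub_limitNTK_le hx hm i)
  simpa only [Fintype.card_fin, kernelDeviation] using lintegral_ofReal_sum_le
    (fun i => Finset.measurable_sum _ fun j _ => hmeas i j)
    (fun i W => Finset.sum_nonneg fun j _ => sq_nonneg _) hrow

end Initialization

section LazyInitialization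

open scoped Matrix

variable {x : Fin n → EuclideanSpace ℝ (Fin p)} {y : Fin n → ℝ} {C δ ε lam R c N : ℝ}

/-- The initializations with output weights `±1`, squared Frobenius deviation of the kernel from its
limit below `ε`, squared residual below `c`, and fewer than `N` pre-activations within `R` of a
kink: the event on which the training is lazy. -/
def lazyEvent (x : Fin n → EuclideanSpace ℝ (Fin p)) (y : Fin n → ℝ) (ε c R N : ℝ) :
    Set (Weights m p × (Fin m → ℝ)) :=
  {ω | kernelDeviation x ω.1 < ε} ∩ {ω | err x y ω.2 ω.1 ⬝ᵥ err x y ω.2 ω.1 < c} ∩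
    {ω | nearKinkCount R (preact x ω.1) < N} ∩ {ω | ∀ r, |ω.2 r| = 1}

theorem measurableSet_lazyEvent (x : Fin n → EuclideanSpace ℝ (Fin p)) (y : Fin n → ℝ)
    (ε c R N : ℝ) : MeasurableSet (lazyEvent (m := m) x y ε c R N) := by
  refine MeasurableSet.inter (.inter (.inter ?_ ?_) ?_) ?_
  · exact measurableSet_lt ((measurable_kernelDeviation x).comp measurable_fst) measurable_const
  · exact measurableSet_lt (measurable_dotProduct_err_initLaw x y) measurable_const
  · exact measurableSet_lt (measurable_nearKinkCount x R) measurable_const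
  · simp only [ofPred_forall]
    exact .iInter fun r => measurableSet_eq_fun (by fun_prop) measurable_const

theorem ofReal_one_sub_le_initLaw_lazyEvent (hx : ∀ i, ‖x i‖ = 1) (hy : ∀ i, |y i| ≤ C)
    (hn : 0 < n) (hm : 0 < m) (hδ : 0 < δ) (hε : 0 < ε) (hR : 0 < R)
    (hwidth : 3 * (n : ℝ) ^ 2 ≤ ε * δ * m) :
    ENNReal.ofReal (1 - δ) ≤ initLaw m p
      (lazyEvent x y ε (3 / δ * (n * (2 + 2 * C ^ 2))) R (3 / δ * (n * (m * R)))) := by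
  have hthird : δ / 3 + δ / 3 + δ / 3 = δ := by ring
  have hkernel := ofReal_one_sub_le_measure_setOf_lt (δ := δ / 3)
    ((measurable_kernelDeviation x).comp measurable_fst) hε (by positivity)
    (lintegral_kernelDeviation_le hx hm)
    (by rw [← mul_assoc, mul_one_div, div_le_iff₀ (by positivity)]; linarith)
  have herr := ofReal_one_sub_le_measure_setOf_lt (δ := δ / 3)
    (measurable_dotProduct_err_initLaw (m := m) x y)
    (by positivity : 0 < 3 / δ * (n * (2 + 2 * C ^ 2))) (by positivity)
    (lintegral_dotProduct_err_le hx hy) (by field_simp; rfl)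
  have hkink := ofReal_one_sub_le_measure_setOf_lt (δ := δ / 3)
    (measurable_nearKinkCount (m := m) x R) (by positivity : 0 < 3 / δ * (n * (m * R)))
    (by positivity) (lintegral_nearKinkCount_le hx R) (by field_simp; rfl)
  have hinter := ofReal_one_sub_add_le_measure_inter
    (ofReal_one_sub_add_le_measure_inter hkernel herr
      (measurableSet_lt (measurable_dotProduct_err_initLaw x y) measurable_const)) hkink
    (measurableSet_lt (measurable_nearKinkCount x R) measurable_const)
  rw [hthird] at hinter
  rwa [lazyEvent, measure_inter_conull ae_abs_sign_eq_one_initLaw]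

theorem isLazyRegime_of_mem_lazyEvent (hx : ∀ i, ‖x i‖ = 1) (hm : 0 < m) (hlam : 0 < lam)
    (hle : lam ≤ lam0 x) (hR : 8 / (3 * lam) * (√(n * c) / √m) ≤ R)
    (hN : n * (N / m) ^ 2 ≤ lam ^ 2 / 256) {c₀ : ℝ} {ω : Weights m p × (Fin m → ℝ)}
    (hω : ω ∈ lazyEvent x y ((lam / 8) ^ 2) c₀ R N) :
    IsLazyRegime (Matrix.gram ℝ x) ω.2 √(2 * lam) R c (preact x ω.1) := by
  obtain ⟨⟨⟨hkernel, -⟩, hkink⟩, hsign⟩ := hω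
  have hb : √(2 * lam) ^ 2 = 2 * lam := Real.sq_sqrt (by positivity)
  have hlimit : ∀ z, lam * (z ⬝ᵥ z) ≤ z ⬝ᵥ limitNTK x *ᵥ z := fun z =>
    (mul_le_mul_of_nonneg_right hle (dotProduct_self_nonneg z)).trans
      (sInf_spectrum_mul_dotProduct_le (isHermitian_limitNTK x) z)
  refine ⟨hm, hsign, Matrix.isHermitian_gram ℝ x, abs_gram_le_one hx, by positivity, fun z => ?_,
    ?_, ?_⟩
  · rw [hb]
    convert coercive_of_sum_sq_sub_le (by positivity) hlimit hkernel.le z using 2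
    ring
  · rwa [hb, show 16 / (3 * (2 * lam)) = 8 / (3 * lam) by field_simp; norm_num]
  · calc n * (nearKinkCount R (preact x ω.1) / m) ^ 2 ≤ n * (N / m) ^ 2 := by
          gcongr
          · exact div_nonneg (nearKinkCount_nonneg _ _) m.cast_nonneg
          · exact hkink.le
      _ ≤ lam ^ 2 / 256 := hN
      _ = √(2 * lam) ^ 4 / 1024 := by
          rw [show √(2 * lam) ^ 4 = (√(2 * lam) ^ 2) ^ 2 by ring, hb]
          ring

theorem three_mul_sq_le_of_width (hn : 0 < n) (hδ : 0 < δ) (hδ₁ : δ ≤ 1) (hlam : 0 < lam)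
    (hlam₁ : lam ≤ 1) (hm : 192 * ((n : ℝ) ^ 5 / (δ ^ 3 * lam ^ 4)) ≤ m) :
    3 * (n : ℝ) ^ 2 ≤ (lam / 8) ^ 2 * δ * m := by
  have hpow : (n : ℝ) ^ 2 ≤ n ^ 5 := pow_le_pow_right₀ (by exact_mod_cast hn) (by norm_num)
  have hsmall : δ ^ 3 * lam ^ 4 ≤ δ * lam ^ 2 :=
    mul_le_mul (pow_le_of_le_one hδ.le hδ₁ three_ne_zero)
      (pow_le_pow_of_le_one hlam.le hlam₁ (by norm_num)) (by positivity) hδ.le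
  calc 3 * (n : ℝ) ^ 2 ≤ 3 * n ^ 5 := by gcongr
    _ = δ ^ 3 * lam ^ 4 / 64 * (192 * (n ^ 5 / (δ ^ 3 * lam ^ 4))) := by
        field_simp
        norm_num
    _ ≤ δ * lam ^ 2 / 64 * m := by gcongr
    _ = (lam / 8) ^ 2 * δ * m := by ring

-- `344064 = 256 * 1344`, where `1344 = 3 ^ 2 * (8 / 3) ^ 2 * (7 / 2 * 3 * 2)` collects the
-- constants of `R` and `c`.
theorem mul_sq_nearKink_le_of_width (hm₀ : 0 < m) (hδ : 0 < δ) (hlam : 0 < lam)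
    (hc : c = 3 / δ * (n * (2 + 2 * C ^ 2)))
    (hR : R = 8 / (3 * lam) * (√(n * (7 / 2 * c)) / √m))
    (hm : 344064 * (C ^ 2 + 1) * ((n : ℝ) ^ 5 / (δ ^ 3 * lam ^ 4)) ≤ m) :
    n * (3 / δ * (n * (m * R)) / m) ^ 2 ≤ lam ^ 2 / 256 := by
  have hm' : (0 : ℝ) < m := by exact_mod_cast hm₀
  have hc_nonneg : 0 ≤ c := hc ▸ by positivity
  calc n * (3 / δ * (n * (m * R)) / m) ^ 2
      = n * (3 / δ * (n * (8 / (3 * lam)))) ^ 2 * (√(n * (7 / 2 * c)) ^ 2 / √m ^ 2) := by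
        rw [hR]
        field_simp
    _ = lam ^ 2 / 256 * (344064 * (C ^ 2 + 1) * (n ^ 5 / (δ ^ 3 * lam ^ 4))) / m := by
        rw [Real.sq_sqrt (by positivity), Real.sq_sqrt hm'.le, hc]
        field_simp
        ring
    _ ≤ lam ^ 2 / 256 * m / m := by gcongr
    _ = lam ^ 2 / 256 := mul_div_cancel_right₀ _ hm'.ne'

theorem exists_measurableSet_isLazyRegime (hx : ∀ i, ‖x i‖ = 1) (hy : ∀ i, |y i| ≤ C) (hδ : 0 < δ)
    (hδ₁ : δ ≤ 1) (hlam : 0 < lam) (hle : lam ≤ lam0 x)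
    (hm : 344064 * (C ^ 2 + 1) * ((n : ℝ) ^ 5 / (δ ^ 3 * lam ^ 4)) ≤ m) :
    ∃ S : Set (Weights m p × (Fin m → ℝ)), MeasurableSet S ∧
      ENNReal.ofReal (1 - δ) ≤ initLaw m p S ∧ ∃ R c, ∀ ω ∈ S,
        IsLazyRegime (Matrix.gram ℝ x) ω.2 √(2 * lam) R c (preact x ω.1) ∧
        7 / 2 * (err x y ω.2 ω.1 ⬝ᵥ err x y ω.2 ω.1) < c := by
  have hn : 0 < n := card_pos_of_lam0_pos (hlam.trans_le hle)
  have hm₀ : 0 < m := by exact_mod_cast (show (0 : ℝ) < m from hm.trans_lt' (by positivity))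
  let c := 3 / δ * (n * (2 + 2 * C ^ 2))
  let R := 8 / (3 * lam) * (√(n * (7 / 2 * c)) / √m)
  have hkernel : 3 * (n : ℝ) ^ 2 ≤ (lam / 8) ^ 2 * δ * m :=
    three_mul_sq_le_of_width hn hδ hδ₁ hlam (hle.trans (lam0_le_one hx hn)) (hm.trans' (by
      gcongr
      linarith [sq_nonneg C]))
  refine ⟨lazyEvent x y ((lam / 8) ^ 2) c R (3 / δ * (n * (m * R))),
    measurableSet_lazyEvent x y _ _ _ _, ofReal_one_sub_le_initLaw_lazyEvent hx hy hn hm₀ hδ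
      (by positivity) (by positivity) hkernel, R, 7 / 2 * c, fun ω hω =>
    ⟨isLazyRegime_of_mem_lazyEvent hx hm₀ hlam hle le_rfl
      (mul_sq_nearKink_le_of_width hm₀ hδ hlam rfl rfl hm) hω, ?_⟩⟩
  exact mul_lt_mul_of_pos_left hω.1.1.2 (by norm_num)

end LazyInitialization

end NAGSC

end

open NAGSC in
theorem mainTheorem3_general :
    (∀ (n p m : ℕ) (x : Fin n → EuclideanSpace ℝ (Fin p)) (y : Fin n → ℝ) (a : Fin m → ℝ)
      (lam : ℝ) (X X' : ℝ → Weights m p) (X'' : Weights m p) (t : ℝ),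
      (∀ᶠ s in 𝓝 t, HasDerivAt X (X' s) s) → HasDerivAt X' X'' t →
      (∀ r i, inner ℝ (X t r) (x i) ≠ 0) →
      Tendsto (fun η : ℝ => η⁻¹ • (X (t + √η) -
          accelStep (lossGrad x y a) (nagMomentum lam η) η (X (t - √η)) (X t)))
        (𝓝[>] 0) (𝓝 (X'' + √(2 * lam) • X' t + lossGrad x y a (X t)))) ∧
    (∀ C : ℝ, ∃ K : ℝ, 0 < K ∧
      ∀ (n p m : ℕ) (x : Fin n → EuclideanSpace ℝ (Fin p)) (y : Fin n → ℝ) (δ lam : ℝ),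
        (∀ i, ‖x i‖ = 1) → (∀ i, |y i| ≤ C) → 0 < δ → δ ≤ 1 → 0 < lam → lam ≤ lam0 x →
        K * ((n : ℝ) ^ 5 / (δ ^ 3 * lam ^ 4)) ≤ m →
        ∃ S : Set (Weights m p × (Fin m → ℝ)), MeasurableSet S ∧
          ENNReal.ofReal (1 - δ) ≤ initLaw m p S ∧
          ∀ ω ∈ S, ∀ W : ℝ → Weights m p,
            IsHBFlow x y ω.2 √(2 * lam) ω.1 W →
            ∀ t : ℝ, 0 ≤ t →
              loss x y ω.2 (W t) ≤
                4 / lam * Real.exp (-√(lam / 2) * t) * pseudoLoss x y ω.2 ω.1) := by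
  refine ⟨fun n p m x y a lam X X' X'' t hX hX' hne =>
      tendsto_accelStep lam hX hX' (continuousAt_lossGrad y a hne),
    fun C => ⟨344064 * (C ^ 2 + 1), by positivity, ?_⟩⟩
  intro n p m x y δ lam hx hy hδ hδ₁ hlam hle hm
  obtain ⟨S, hS, hprob, R, c, hlazy⟩ :=
    exists_measurableSet_isLazyRegime hx hy hδ hδ₁ hlam hle hm
  exact ⟨S, hS, hprob, fun ω hω W hflow t ht =>
    hflow.loss_le (hlazy ω hω).1 (hlazy ω hω).2 ht⟩

open NAGSC in
theorem mainTheorem3 :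
    -- the limiting ODE of NAG-SC (time step `√η`) is the Heavy Ball ODE with `b = √(2λ₀)`
    (∀ (n p m : ℕ) (x : Fin n → EuclideanSpace ℝ (Fin p)) (y : Fin n → ℝ) (a : Fin m → ℝ)
      (X X' : ℝ → Weights m p) (X'' : Weights m p) (t : ℝ),
      (∀ᶠ s in 𝓝 t, HasDerivAt X (X' s) s) → HasDerivAt X' X'' t →
      (∀ r i, inner ℝ (X t r) (x i) ≠ 0) →
      Tendsto (fun η : ℝ => η⁻¹ • (X (t + √η) - nagStep x y a η (X (t - √η)) (X t)))
        (𝓝[>] 0) (𝓝 (X'' + √(2 * lam0 x) • X' t + lossGrad x y a (X t)))) ∧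
    -- linear convergence with high probability over the initialization
    (∀ C : ℝ, ∃ K : ℝ, 0 < K ∧
      ∀ (n p m : ℕ) (x : Fin n → EuclideanSpace ℝ (Fin p)) (y : Fin n → ℝ) (δ : ℝ),
        (∀ i, ‖x i‖ = 1) → (∀ i, |y i| < C) → 0 < δ → δ < 1 → 0 < lam0 x →
        K * ((n : ℝ) ^ 6 / (δ ^ 3 * lam0 x ^ 4)) ≤ m →
        ∃ S : Set (Weights m p × (Fin m → ℝ)), MeasurableSet S ∧
          ENNReal.ofReal (1 - δ) ≤ initLaw m p S ∧
          ∀ ω ∈ S, ∀ W : ℝ → Weights m p,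
            IsHBFlow x y ω.2 (√(2 * lam0 x)) ω.1 W →
            ∀ t : ℝ, 0 ≤ t →
              loss x y ω.2 (W t) ≤
                4 / lam0 x * Real.exp (-√(lam0 x / 2) * t) * pseudoLoss x y ω.2 ω.1) := by
  refine ⟨fun n p m x y a => mainTheorem3_general.1 n p m x y a (lam0 x), fun C => ?_⟩
  obtain ⟨K, hK, hconv⟩ := mainTheorem3_general.2 C
  refine ⟨K, hK, fun n p m x y δ hx hy hδ hδ₁ hlam hm =>
    hconv n p m x y δ (lam0 x) hx (fun i => (hy i).le) hδ hδ₁.le hlam le_rfl (hm.trans' ?_)⟩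
  have hn : (1 : ℝ) ≤ n := by exact_mod_cast card_pos_of_lam0_pos hlam
  gcongr
  norm_num
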